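/- Let $f$ be a nonconstant rational function mapping the unit circle $\mathbf S^1$ into itself (equivalently, a nonconstant real rational function after $\overline{\mathbb R}$ is identified with $\mathbf S^1$ by a Möbius map $\vartheta$ and $f$ is replaced by $\vartheta\circ f\circ\vartheta^{-1}$), and suppose that all critical points of $f$ in $\overline{\mathbb C}$ lie on $\mathbf S^1$. The net of $f$ is $\Gamma=f^{-1}(\mathbf S^1)$; its vertices are the critical points of $f$ (a vertex is simple if it is a simple zero of the Wronskian $p'q-pq'$, where $f=p/q$ in lowest terms), its edges are the connected components of $\Gamma$ minus the vertices, and its chords are the edges inside the open unit disc. A chord connects two vertices if both lie in its closure. Let $r\ne s$ be points of $\mathbf S^1$, and let $[r,s]$ and $(r,s)$ be the closed and open positively oriented arcs from $r$ to $s$. Let $y_1<\dots<y_n$ ($n\ge 0$) be all the vertices of $\Gamma$ in $(r,s)$, in the order of the arc, and suppose that they are all simple and that $f$ preserves orientation on $(r,y_1)$ (on $(r,s)$ if $n=0$). Let $Y_\Gamma(r,s)$ be the two-row tableau with entries $1,\dots,n$ in which $i$ is in the second row if and only if $y_i$ is connected by a chord of $\Gamma$ to $y_j$ for some $j<i$,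 and in the first row otherwise. Let $E$ and $O$ be the numbers of even and odd entries in the second row. Let $L([r,s])$ be the argument increment of $f$ on $[r,s]$, i.e. the total change along $[r,s]$ of a continuous branch of $\arg f$. Then $L([r,s])$ is well defined and $$L([r,s])\in\Big(\big[((n+1)\bmod 2)-n+4O-1\big]\pi,\ \big[((n+1)\bmod 2)+n-4E+1\big]\pi\Big).$$ -/

import Mathlib

open Polynomial Set

/-- A real rational function, viewed as a self-map of the Riemann sphere preserving the unit
circle, all of whose critical points lie on the unit circle.  It is written in lowest terms as
`num / denom`.  Up to a Möbius map carrying the real projective line to the unit circle, these are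
exactly the nonconstant real rational functions with only real critical points. -/
structure CircleRatFun where
  num : ℂ[X]
  denom : ℂ[X]
  coprime : IsCoprime num denom
  /-- The unit circle is mapped to itself. -/
  maps_circle : ∀ z : ℂ, ‖z‖ = 1 → ‖num.eval z / denom.eval z‖ = 1
  /-- All finite critical points, i.e. zeros of the Wronskian `num' * denom - num * denom'`, lie on
  the unit circle. -/
  crit_circle : ∀ z : ℂ, (wronskian denom num).IsRoot z → ‖z‖ = 1
  /-- The Wronskian has degree `2 d - 2`, where `d` is the degree of the rational function;
  in other words the point at infinity is not critical (and `d ≥ 1`). -/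
  crit_infty : (wronskian denom num).natDegree + 2 = 2 * max num.natDegree denom.natDegree

namespace CircleRatFun

/-- The Wronskian `num' * denom - num * denom'`; its zeros are the critical points, counted with
multiplicity. -/
noncomputable def W (f : CircleRatFun) : ℂ[X] := wronskian f.denom f.num

/-- The value at a point that is not a pole. -/
noncomputable def val (f : CircleRatFun) (z : ℂ) : ℂ := f.num.eval z / f.denom.eval z

/-- The net: the preimage of the unit circle.  (Only its finite points are recorded; the point at
infinity plays no role for the chords, which lie inside the unit disc.) -/
def net (f : CircleRatFun) : Set ℂ := {z | ‖f.val z‖ = 1}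

/-- The vertices of the net: the critical points. -/
def vertices (f : CircleRatFun) : Set ℂ := {z | f.W.IsRoot z}

/-- A vertex is simple if it is a simple zero of the Wronskian. -/
def IsSimpleVertex (f : CircleRatFun) (z : ℂ) : Prop := f.W.rootMultiplicity z = 1

/-- A chord of the net: an edge, i.e. a connected component of the net minus its vertices, that
lies inside the unit disc. -/
def IsChord (f : CircleRatFun) (e : Set ℂ) : Prop :=
  (∃ z ∈ f.net \ f.vertices, e = connectedComponentIn (f.net \ f.vertices) z) ∧
    e ⊆ Metric.ball 0 1

/-- Two points of the unit circle are connected by a chord if both are ends of one chord. -/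
def ChordJoins (f : CircleRatFun) (z w : ℂ) : Prop :=
  ∃ e, f.IsChord e ∧ z ∈ closure e ∧ w ∈ closure e

end CircleRatFun

/-- The point of the unit circle with the angle `t`. -/
noncomputable def circlePt (t : ℝ) : ℂ := Complex.exp (t * Complex.I)

namespace CircleRatFun

/-- `φ` is a continuous choice, on the set `A` of angles, of the argument of `f` on the unit
circle. -/
def IsArgOn (f : CircleRatFun) (A : Set ℝ) (φ : ℝ → ℝ) : Prop :=
  ContinuousOn φ A ∧ ∀ t ∈ A, f.val (circlePt t) = circlePt (φ t)

/-- `l` is the argument increment of `f` on the positively oriented closed arc of the unit circle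
from the angle `α` to the angle `β`. -/
def HasArgIncrement (f : CircleRatFun) (α β l : ℝ) : Prop :=
  ∃ φ : ℝ → ℝ, f.IsArgOn (Icc α β) φ ∧ φ β - φ α = l

/-- `f` preserves orientation on the open arc of the unit circle from the angle `α` to the
angle `β`. -/
def OrientationPreservingOn (f : CircleRatFun) (α β : ℝ) : Prop :=
  ∃ φ : ℝ → ℝ, f.IsArgOn (Ioo α β) φ ∧ StrictMonoOn φ (Ioo α β)

/-- `θ 0 < ⋯ < θ (n - 1)` are the angles of all the vertices of the net in the open arc of the
unit circle from the angle `α` to the angle `β`. -/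
def IsVertexList (f : CircleRatFun) (α β : ℝ) {n : ℕ} (θ : Fin n → ℝ) : Prop :=
  StrictMono θ ∧ range θ = {t | t ∈ Ioo α β ∧ circlePt t ∈ f.vertices}

open Classical in
/-- The second row of the Young tableau of the net for an arc with the vertices
`y₁ < ⋯ < yₙ`, where `yᵢ` has the angle `θ (i - 1)`: the entry `i` (with `1 ≤ i ≤ n`) is in the
second row if and only if `yᵢ` is connected by a chord to some `yⱼ` with `j < i`.  The remaining
entries form the first row. -/
noncomputable def secondRow (f : CircleRatFun) {n : ℕ} (θ : Fin n → ℝ) : Finset ℕ :=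
  (Finset.univ.filter fun i : Fin n =>
    ∃ j < i, f.ChordJoins (circlePt (θ j)) (circlePt (θ i))).image fun i => (i : ℕ) + 1

/-- The number of even entries in the second row. -/
noncomputable def evenEntries (f : CircleRatFun) {n : ℕ} (θ : Fin n → ℝ) : ℕ :=
  ((f.secondRow θ).filter fun i => Even i).card

/-- The number of odd entries in the second row. -/
noncomputable def oddEntries (f : CircleRatFun) {n : ℕ} (θ : Fin n → ℝ) : ℕ :=
  ((f.secondRow θ).filter fun i => Odd i).card

end CircleRatFun

/-! The net cuts the unit disc into faces, and f has no critical points inside the disc. Hence f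
maps each face with |f| < 1 bijectively onto the disc, and 1/f does so for each face with |f| > 1. A
face is encoded as an inverse branch on the closed disc (`Face`), obtained by covering theory
(`exists_lift_ball`) and extended to the boundary by finiteness of the fibres
(`exists_face_of_norm_lt`). This replaces any planar topology of the net.

Two facts about a face carry the proof. If t < t' < t + 2π are angles of circle points on its
boundary, the argument of f followed along that boundary changes by an amount strictly between 0 and
2π, with the sign + for |f| < 1 and − for |f| > 1 (`Face.exists_argument`). And the gaps between
circle points on the boundaries of faces correspond to the chords (`chordJoins_of_gap`,
`exists_gap_of_chordJoins`).

Let F i be the face adjacent to the i-th arc of [r, s]. At a simple vertex the kinds of the two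
adjacent faces differ, so F i has the sign (-1)^i, and no third face contains the vertex. If i < k
are consecutive visits to one face, a chord joins vertices i + 1 and k. Then k is in the second row,
i + 1 is not, and the face across the chord is F (i + 1) = F (k - 1). The argument increments of the
two faces between the ends of the chord are congruent modulo 2π and have opposite signs, so they
differ by exactly one turn, with the sign (-1)^k (`of_consecutive`).

By induction, between two visits to one face the argument of f changes by the increment of the face
plus 2π(O − E), where O and E count the second-row entries passed, and the number of arcs passed is
2(O + E) (`argument_sub_eq`). For the bounds, the last arc is compared with the first arc on the
same face: beyond that arc the increment is known up to less than one turn, and before it induction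
applies (`argument_bounds`). -/

section

open Polynomial Set Metric Filter Topology ComplexConjugate

/-! ### Reciprocals, reflection in the circle and local behaviour -/

namespace CircleRatFun

variable (f : CircleRatFun)

lemma eval_ne_zero_or (z : ℂ) : f.num.eval z ≠ 0 ∨ f.denom.eval z ≠ 0 := by
  obtain ⟨u, v, h⟩ := f.coprime
  by_contra! hz
  have := congrArg (Polynomial.eval z) h
  simp [hz.1, hz.2] at this

lemma denom_ne_zero_of_eq {z w : ℂ} (h : f.num.eval z = w * f.denom.eval z) :
    f.denom.eval z ≠ 0 := by
  intro h0
  rcases f.eval_ne_zero_or z with h1 | h1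
  · exact h1 (by simp [h, h0])
  · exact h1 h0

lemma denom_ne_zero_of_norm {z : ℂ} (h : ‖z‖ = 1) : f.denom.eval z ≠ 0 := by
  intro h0
  simpa [h0] using f.maps_circle z h

lemma num_ne_zero_of_norm {z : ℂ} (h : ‖z‖ = 1) : f.num.eval z ≠ 0 := by
  intro h0
  simpa [h0] using f.maps_circle z h

lemma norm_num_eq {z : ℂ} (h : ‖z‖ = 1) : ‖f.num.eval z‖ = ‖f.denom.eval z‖ := by
  have := f.maps_circle z h
  rwa [norm_div, div_eq_one_iff_eq (by simpa using f.denom_ne_zero_of_norm h)] at this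

/-- The reciprocal of a rational function. -/
def swap : CircleRatFun where
  num := f.denom
  denom := f.num
  coprime := f.coprime.symm
  maps_circle z hz := by
    have := f.maps_circle z hz
    rw [← inv_div, norm_inv, this, inv_one]
  crit_circle z hz := by
    apply f.crit_circle z
    rw [← wronskian_neg_eq] at hz
    simpa [IsRoot] using hz
  crit_infty := by
    rw [← wronskian_neg_eq, natDegree_neg, max_comm]
    exact f.crit_infty

lemma swap_W : f.swap.W = -f.W := (wronskian_neg_eq _ _).symm

lemma val_swap (z : ℂ) : f.swap.val z = (f.val z)⁻¹ := (inv_div _ _).symm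

lemma vertices_swap : f.swap.vertices = f.vertices := by
  ext z; simp [vertices, swap_W, IsRoot]

lemma net_swap : f.swap.net = f.net := by
  ext z; simp [net, val_swap]

lemma chordJoins_swap (z w : ℂ) : f.swap.ChordJoins z w ↔ f.ChordJoins z w := by
  simp [ChordJoins, IsChord, net_swap, vertices_swap]

lemma IsSimpleVertex.derivative_ne_zero {f : CircleRatFun} (hW : f.W ≠ 0) {z : ℂ}
    (h : f.IsSimpleVertex z) : (derivative f.W).eval z ≠ 0 := fun h0 => by
  have h1 : f.W.IsRoot z := (rootMultiplicity_pos hW).1 (by rw [h]; exact one_pos)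
  have := (one_lt_rootMultiplicity_iff_isRoot hW).2 ⟨h1, h0⟩
  rw [h] at this
  exact lt_irrefl _ this

lemma val_eq_iff {z w : ℂ} (h : f.denom.eval z ≠ 0) :
    f.val z = w ↔ f.num.eval z = w * f.denom.eval z := div_eq_iff h

lemma denom_ne_zero_of_norm_val {z : ℂ} (h : ‖f.val z‖ = 1) : f.denom.eval z ≠ 0 := by
  intro h0; simp [val, h0] at h

lemma norm_val_circle {z : ℂ} (h : ‖z‖ = 1) : ‖f.val z‖ = 1 := f.maps_circle z h

lemma W_eval (z : ℂ) : f.W.eval z = f.denom.eval z * (derivative f.num).eval z -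
    (derivative f.denom).eval z * f.num.eval z := by
  simp [W, wronskian]

lemma W_ne_zero_of_mem_ball {z : ℂ} (hz : z ∈ ball (0 : ℂ) 1) : f.W.eval z ≠ 0 := fun h => by
  have := f.crit_circle z h
  rw [mem_ball_zero_iff] at hz
  linarith

lemma W_ne_zero : f.W ≠ 0 := fun h =>
  f.W_ne_zero_of_mem_ball (mem_ball_self one_pos) (by simp [h])

lemma hasStrictDerivAt_val {z : ℂ} (h : f.denom.eval z ≠ 0) :
    HasStrictDerivAt f.val (f.W.eval z / f.denom.eval z ^ 2) z := by
  have := (f.num.hasStrictDerivAt z).div (f.denom.hasStrictDerivAt z) h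
  rw [W_eval]
  convert! this using 1
  ring

lemma continuousAt_val {z : ℂ} (h : f.denom.eval z ≠ 0) : ContinuousAt f.val z :=
  (f.hasStrictDerivAt_val h).hasDerivAt.continuousAt

lemma exists_injOn_nhds {z : ℂ} (h : f.denom.eval z ≠ 0) (hW : f.W.eval z ≠ 0) :
    ∃ N ∈ 𝓝 z, InjOn f.val N := by
  have h1 := (f.hasStrictDerivAt_val h).hasStrictFDerivAt_equiv
    (div_ne_zero hW (pow_ne_zero 2 h))
  refine ⟨_, h1.toOpenPartialHomeomorph.open_source.mem_nhds
    h1.mem_toOpenPartialHomeomorph_source, ?_⟩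
  simpa using h1.toOpenPartialHomeomorph.injOn

/-- Schwarz reflection f(1/z̄) = 1/conj f(z), without division. Multiplied by z^N it becomes an
identity between polynomials (reversed and conjugated), and it holds at the infinitely many points
of the circle because |num| = |denom| there. -/
lemma reflect_identity {z : ℂ} (hz : z ≠ 0) :
    f.num.eval z * conj (f.num.eval (conj z)⁻¹) =
      f.denom.eval z * conj (f.denom.eval (conj z)⁻¹) := by
  set N := max f.num.natDegree f.denom.natDegree
  have key (p : ℂ[X]) (hp : p.natDegree ≤ N) (z : ℂ) (hz : z ≠ 0) :
      (reflect N (p.map (starRingEnd ℂ))).eval z = z ^ N * conj (p.eval (conj z)⁻¹) := by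
    let := invertibleOfNonzero (inv_ne_zero hz)
    have h1 := eval₂_reflect_mul_pow (RingHom.id ℂ) z⁻¹ N (p.map (starRingEnd ℂ))
      (natDegree_map_le.trans hp)
    rw [invOf_eq_inv, inv_inv, ← eval, ← eval] at h1
    have h2 : conj (p.eval (conj z)⁻¹) = eval z⁻¹ (p.map (starRingEnd ℂ)) := by
      have h3 := Polynomial.eval_map_apply (starRingEnd ℂ) (p := p) (conj z)⁻¹
      rw [map_inv₀, Complex.conj_conj] at h3
      exact h3.symm
    rw [h2, ← h1, mul_comm, mul_assoc, inv_pow, inv_mul_cancel₀ (pow_ne_zero N hz), mul_one]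
  have hPQ : f.num * reflect N (f.num.map (starRingEnd ℂ)) =
      f.denom * reflect N (f.denom.map (starRingEnd ℂ)) := by
    apply Polynomial.eq_of_infinite_eval_eq
    refine Set.Infinite.mono (s := sphere (0 : ℂ) 1) ?_ ?_
    · intro w hw
      rw [mem_sphere_zero_iff_norm] at hw
      have hw0 : w ≠ 0 := by rintro rfl; simp at hw
      have h3 : (conj w)⁻¹ = w := by
        rw [← Complex.inv_eq_conj hw, inv_inv]
      simp only [mem_ofPred_eq, eval_mul]
      rw [key _ (le_max_left _ _) w hw0, key _ (le_max_right _ _) w hw0, h3]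
      have h4 := f.norm_num_eq hw
      have h5 := Complex.mul_conj' (f.num.eval w)
      have h6 := Complex.mul_conj' (f.denom.eval w)
      rw [h4, ← h6] at h5
      linear_combination w ^ N * h5
    · have h0 : IsPreconnected (sphere (0 : ℂ) 1) :=
        isPreconnected_sphere (by simp [Complex.rank_real_complex]) 0 1
      exact h0.infinite_of_nontrivial ⟨1, by simp, -1, by simp, by norm_num⟩
  have := congrArg (Polynomial.eval z) hPQ
  rw [eval_mul, eval_mul, key _ (le_max_left _ _) z hz, key _ (le_max_right _ _) z hz] at this
  apply mul_left_cancel₀ (pow_ne_zero N hz)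
  linear_combination this

lemma val_inv_conj {z : ℂ} (hz : z ≠ 0) (hn : f.num.eval z ≠ 0) :
    f.denom.eval (conj z)⁻¹ ≠ 0 ∧ f.val (conj z)⁻¹ = (conj (f.val z))⁻¹ := by
  have h1 := f.reflect_identity hz
  have h2 : f.num.eval (conj z)⁻¹ = (conj (f.val z))⁻¹ * f.denom.eval (conj z)⁻¹ := by
    have h3 : conj (f.num.eval (conj z)⁻¹) = (f.val z)⁻¹ * conj (f.denom.eval (conj z)⁻¹) := by
      apply mul_left_cancel₀ hn
      rw [h1, val, inv_div]
      field_simp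
    simpa using congrArg conj h3
  have h4 := f.denom_ne_zero_of_eq h2
  exact ⟨h4, (f.val_eq_iff h4).2 h2⟩

lemma tendsto_inv_conj {z : ℂ} (hz : ‖z‖ = 1) : Tendsto (fun w => (conj w)⁻¹) (𝓝 z) (𝓝 z) := by
  have h0 : conj z ≠ 0 := by
    intro h
    rw [← Complex.norm_conj, h] at hz
    simp at hz
  have h1 : ContinuousAt (fun w => (conj w)⁻¹) z :=
    (Complex.continuous_conj.continuousAt).inv₀ h0
  have h2 : (conj z)⁻¹ = z := by rw [← Complex.inv_eq_conj hz, inv_inv]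
  simpa [ContinuousAt, h2] using h1

lemma one_lt_norm_inv_conj {z : ℂ} (h0 : z ≠ 0) (hz : ‖z‖ < 1) : 1 < ‖(conj z)⁻¹‖ := by
  rw [norm_inv, Complex.norm_conj]
  exact (one_lt_inv₀ (norm_pos_iff.2 h0)).2 hz

/-- Inside the disc the net does not accumulate at a point of the circle that is not critical. -/
lemma eventually_norm_val_ne_one {z : ℂ} (hz : ‖z‖ = 1) (hW : f.W.eval z ≠ 0) :
    ∀ᶠ w in 𝓝 z, ‖w‖ < 1 → ‖f.val w‖ ≠ 1 := by
  obtain ⟨N, hN, hinj⟩ := f.exists_injOn_nhds (f.denom_ne_zero_of_norm hz) hW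
  have hz0 : z ≠ 0 := by rintro rfl; simp at hz
  filter_upwards [hN, tendsto_inv_conj hz hN, isOpen_ne.mem_nhds hz0] with w h1 h2 h3 h4 h5
  have hn : f.num.eval w ≠ 0 := fun h => by simp [val, h] at h5
  -- Since |f(w)| = 1, reflection gives f(1/w̄) = f(w): two preimages near z, one on each side of
  -- the circle, against local injectivity.
  have h6 := (f.val_inv_conj h3 hn).2
  rw [← Complex.inv_eq_conj h5, inv_inv] at h6
  have h7 := one_lt_norm_inv_conj h3 h4
  have h8 : (conj w)⁻¹ = w := hinj h2 h1 h6
  rw [h8] at h7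
  linarith

end CircleRatFun

/-! ### Two topological criteria -/

/-- Two functions that are continuous on a preconnected set agree on it, if they agree somewhere
and locally around each point where they agree. -/
lemma IsPreconnected.eqOn_of_eventually_eq {X Y : Type*} [TopologicalSpace X] [TopologicalSpace Y]
    [T2Space Y] {s : Set X} (hs : IsPreconnected s) {g h : X → Y} (hg : ContinuousOn g s)
    (hh : ContinuousOn h s) (hloc : ∀ x ∈ s, g x = h x → ∀ᶠ y in 𝓝[s] x, g y = h y)
    {x₀ : X} (hx₀ : x₀ ∈ s) (h0 : g x₀ = h x₀) : EqOn g h s := by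
  have := isPreconnected_iff_preconnectedSpace.1 hs
  have hcl : IsClopen {x : s | g x = h x} := by
    refine ⟨isClosed_eq (continuousOn_iff_continuous_domRestrict.1 hg)
      (continuousOn_iff_continuous_domRestrict.1 hh), ?_⟩
    rw [isOpen_iff_mem_nhds]
    rintro ⟨x, hx⟩ hxe
    have := hloc x hx hxe
    rw [nhdsWithin_eq_map_subtype_coe hx, eventually_map] at this
    exact this
  have h1 := hcl.eq_univ ⟨⟨x₀, hx₀⟩, h0⟩
  intro x hx
  have : (⟨x, hx⟩ : s) ∈ {x : s | g x = h x} := by rw [h1]; trivial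
  exact this

/-- A function whose cluster points along a filter belong to a finite set has a limit, if
it maps arbitrarily small sets of the filter to preconnected sets. -/
lemma exists_tendsto_of_finite_mapClusterPt {X Y : Type*} [TopologicalSpace Y] [T2Space Y]
    {l : Filter X} [NeBot l] {g : X → Y} {K R : Set Y} (hK : IsCompact K)
    (hgK : ∀ᶠ x in l, g x ∈ K) (hR : R.Finite) (hcl : ∀ r ∈ K, MapClusterPt r l g → r ∈ R)
    (hpre : ∀ s ∈ l, ∃ t ∈ l, t ⊆ s ∧ IsPreconnected (g '' t)) :
    ∃ r ∈ K, Tendsto g l (𝓝 r) := by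
  obtain ⟨r, hrK, hr⟩ := hK.exists_mapClusterPt_of_frequently hgK.frequently
  refine ⟨r, hrK, ?_⟩
  have hsep : SeparatedNhds {r} (R \ {r}) :=
    SeparatedNhds.of_isCompact_isCompact isCompact_singleton
      (hR.subset sdiff_subset).isCompact (by simp)
  obtain ⟨U, U', hU, hU', hrU, hRU', hdisj⟩ := hsep
  rw [_root_.tendsto_nhds]
  intro V hV hrV
  have hrU := singleton_subset_iff.1 hrU
  -- Otherwise compactness gives a cluster point outside both open sets, whereas all cluster points
  -- lie in R. As the two sets are disjoint, a connected image that meets the first stays in it.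
  have hev : ∀ᶠ x in l, g x ∈ (U ∩ V) ∪ U' := by
    by_contra hcon
    have hfr : ∃ᶠ x in l, g x ∈ K \ ((U ∩ V) ∪ U') :=
      ((not_eventually.1 hcon).and_eventually hgK).mono fun x hx => ⟨hx.2, hx.1⟩
    obtain ⟨q, hq, hqc⟩ := (hK.diff ((hU.inter hV).union hU')).exists_mapClusterPt_of_frequently hfr
    have hqR := hcl q hq.1 hqc
    apply hq.2
    by_cases hqr : q = r
    · exact Or.inl (hqr ▸ ⟨hrU, hrV⟩)
    · exact Or.inr (hRU' ⟨hqR, hqr⟩)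
  obtain ⟨t, ht, hts, htp⟩ := hpre _ hev
  have h1 : ∃ᶠ x in l, g x ∈ U ∩ V := mapClusterPt_iff_frequently.1 hr _
    ((hU.inter hV).mem_nhds ⟨hrU, hrV⟩)
  obtain ⟨x, hx, hxt⟩ := (h1.and_eventually ht).exists
  have h2 : g '' t ⊆ U ∩ V := htp.subset_left_of_subset_union (hU.inter hV) hU'
    (hdisj.mono_left inter_subset_left) (image_subset_iff.2 hts) ⟨g x, ⟨x, hxt, rfl⟩, hx⟩
  filter_upwards [ht] with x hx
  exact (h2 ⟨x, hx, rfl⟩).2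

/-! ### Faces as inverse branches -/

namespace CircleRatFun

variable (f : CircleRatFun)

/-- The polynomial num − w·denom is not zero, since otherwise the Wronskian would vanish
identically. -/
lemma finite_fiber (w : ℂ) : {z | f.num.eval z = w * f.denom.eval z}.Finite := by
  have h0 : f.num - C w * f.denom ≠ 0 := by
    intro h
    apply f.W_ne_zero
    rw [W, sub_eq_zero.1 h, wronskian]
    simp
    ring
  refine ((f.num - C w * f.denom).roots.toFinset.finite_toSet).subset fun z hz => ?_
  simp only [mem_ofPred_eq] at hz
  simp [h0, hz]

/-- The values of an inverse branch in the unit disc, through a given point. -/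
lemma exists_lift_ball {z₀ : ℂ} (hz₀ : ‖z₀‖ < 1) (hv : ‖f.num.eval z₀‖ < ‖f.denom.eval z₀‖) :
    ∃ G : ℂ → ℂ, ContinuousOn G (ball 0 1) ∧ MapsTo G (ball 0 1) (ball 0 1) ∧
      (∀ w ∈ ball (0 : ℂ) 1, f.num.eval (G w) = w * f.denom.eval (G w)) ∧ G (f.val z₀) = z₀ := by
  set E : Set ℂ := {z | ‖z‖ < 1 ∧ ‖f.num.eval z‖ < ‖f.denom.eval z‖} with hE
  have hEopen : IsOpen E := by
    exact (isOpen_lt continuous_norm continuous_const).and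
      (isOpen_lt f.num.continuous.norm f.denom.continuous.norm)
  have hd (z : ℂ) (hz : z ∈ E) : f.denom.eval z ≠ 0 := by
    have := (norm_nonneg _).trans_lt hz.2
    simpa using this
  have hball (z : E) : f.val z ∈ ball (0 : ℂ) 1 := by
    rw [mem_ball_zero_iff, val, norm_div, div_lt_one (by simpa using hd z z.2)]
    exact z.2.2
  let p : E → ball (0 : ℂ) 1 := fun z => ⟨f.val z, hball z⟩
  have hpc : Continuous p := by
    refine Continuous.subtype_mk (continuous_iff_continuousAt.2 fun z => ?_) _
    exact (f.continuousAt_val (hd z z.2)).comp continuous_subtype_val.continuousAt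
  -- There are no critical points in the open disc. Together with properness and finite fibres this
  -- makes `p` a covering.
  have hloc : IsLocalHomeomorph p := by
    have h1 : IsLocalHomeomorphOn f.val E := fun z hz => by
      have h2 := (f.hasStrictDerivAt_val (hd z hz)).hasStrictFDerivAt_equiv
        (div_ne_zero (f.W_ne_zero_of_mem_ball (by simpa using hz.1)) (pow_ne_zero 2 (hd z hz)))
      exact ⟨_, h2.mem_toOpenPartialHomeomorph_source, by simp⟩
    have h3 : IsLocalHomeomorph (fun z : E => f.val z) := by
      rw [isLocalHomeomorph_iff_isLocalHomeomorphOn_univ]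
      exact h1.comp (hEopen.isOpenEmbedding_subtypeVal.isLocalHomeomorph.isLocalHomeomorphOn)
        fun z _ => z.2
    exact IsLocalHomeomorph.of_comp (f := p) (g := Subtype.val)
      h3 (isOpen_ball.isOpenEmbedding_subtypeVal.isLocalHomeomorph) hpc
  have hclosed : IsClosedMap p := by
    have : IsProperMap p := by
      rw [isProperMap_iff_ultrafilter]
      refine ⟨hpc, fun 𝒰 y hy => ?_⟩
      have hc : IsCompact (closedBall (0 : ℂ) 1) := isCompact_closedBall 0 1
      obtain ⟨z, hz, hle⟩ := hc.ultrafilter_le_nhds (𝒰.map Subtype.val) (by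
        rw [le_principal_iff, Ultrafilter.mem_coe, Ultrafilter.mem_map]
        exact univ_mem' fun x => by
          simpa using x.2.1.le)
      have hle' : Tendsto (Subtype.val : E → ℂ) 𝒰 (𝓝 z) := hle
      have h1 : Tendsto (fun x : E => f.num.eval (x : ℂ)) 𝒰 (𝓝 (f.num.eval z)) :=
        (f.num.continuous.tendsto z).comp hle'
      have h2 : Tendsto (fun x : E => (p x : ℂ) * f.denom.eval (x : ℂ)) 𝒰
          (𝓝 (y * f.denom.eval z)) :=
        ((continuous_subtype_val.tendsto y).comp hy).mul ((f.denom.continuous.tendsto z).comp hle')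
      have h3 : f.num.eval z = y * f.denom.eval z := by
        refine tendsto_nhds_unique h1 (h2.congr fun x => ?_)
        exact ((f.val_eq_iff (hd x x.2)).1 rfl).symm
      have hdz := f.denom_ne_zero_of_eq h3
      have hy1 : ‖(y : ℂ)‖ < 1 := mem_ball_zero_iff.1 y.2
      have hlt : ‖f.num.eval z‖ < ‖f.denom.eval z‖ := by
        rw [h3, norm_mul]
        exact mul_lt_of_lt_one_left (norm_pos_iff.2 hdz) hy1
      -- A limit point cannot reach the circle, where |f| = 1, because the limit value y satisfies
      -- |y| < 1.
      have hzE : z ∈ E := by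
        refine ⟨lt_of_le_of_ne (by simpa using hz) fun h => ?_, hlt⟩
        exact hlt.ne (f.norm_num_eq h)
      refine ⟨⟨z, hzE⟩, Subtype.ext ((f.val_eq_iff hdz).2 h3), ?_⟩
      rw [nhds_subtype_eq_comap, ← tendsto_iff_comap]
      exact hle'
    exact this.isClosedMap
  have hcov : IsCoveringMap p := by
    rw [isCoveringMap_iff_isCoveringMapOn_univ]
    refine hclosed.isCoveringMapOn_of_isLocalHomeomorphOn (fun x _ => ?_)
      (fun z _ => hloc z)
    refine Set.Finite.of_finite_image (f := Subtype.val)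
      ((f.finite_fiber x).subset ?_) Subtype.val_injective.injOn
    rintro _ ⟨z, hz, rfl⟩
    exact (f.val_eq_iff (hd z z.2)).1 (congrArg Subtype.val hz)
  have : ContractibleSpace (ball (0 : ℂ) 1) :=
    (convex_ball (0 : ℂ) 1).contractibleSpace ⟨0, by simp⟩
  have : LocallyPathConnectedSpace (ball (0 : ℂ) 1) :=
    (isOpen_ball (x := (0 : ℂ)) (ε := 1)).locallyPathConnectedSpace
  -- The disc is simply connected, so its identity map lifts to a section of the covering through
  -- z₀.
  obtain ⟨F, ⟨hF0, hF⟩, -⟩ := hcov.existsUnique_continuousMap_lifts (ContinuousMap.id (ball (0 : ℂ) 1))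
    (p ⟨z₀, hz₀, hv⟩) ⟨z₀, hz₀, hv⟩ rfl
  classical
  refine ⟨fun w => if h : w ∈ ball (0 : ℂ) 1 then F ⟨w, h⟩ else 0, ?_, ?_, ?_, ?_⟩
  · rw [continuousOn_iff_continuous_domRestrict]
    have : (ball (0 : ℂ) 1).domRestrict (fun w => if h : w ∈ ball (0 : ℂ) 1 then (F ⟨w, h⟩ : ℂ) else 0)
        = fun w => (F w : ℂ) := by
      ext w; simp only [domRestrict_apply, w.2, dite_true]
    rw [this]
    exact continuous_subtype_val.comp F.continuous
  · intro w hw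
    simp only [hw, dite_true]
    simpa using (F ⟨w, hw⟩).2.1
  · intro w hw
    simp only [hw, dite_true]
    have h1 := congrArg Subtype.val (congrFun hF ⟨w, hw⟩)
    exact (f.val_eq_iff (hd _ (F ⟨w, hw⟩).2)).1 h1
  · have h1 : f.val z₀ ∈ ball (0 : ℂ) 1 := hball ⟨z₀, hz₀, hv⟩
    simp only [h1, dite_true]
    exact congrArg Subtype.val hF0

/-- An inverse branch of a rational function on the closed unit disc, with values in the closed
unit disc.  Its image is the closure of a component of the complement of the net. -/
@[ext]
structure Face where
  toFun : ℂ → ℂ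
  cont : ContinuousOn toFun (closedBall 0 1)
  maps : MapsTo toFun (ball 0 1) (ball 0 1)
  eqn : ∀ w ∈ closedBall (0 : ℂ) 1, f.num.eval (toFun w) = w * f.denom.eval (toFun w)
  outside : ∀ w ∉ closedBall (0 : ℂ) 1, toFun w = 0

instance : CoeFun (Face f) fun _ => ℂ → ℂ := ⟨Face.toFun⟩

/-- There is an inverse branch through each point of the disc with a value in the disc. -/
lemma exists_face_of_norm_lt {z₀ : ℂ} (hz₀ : ‖z₀‖ < 1)
    (hv : ‖f.num.eval z₀‖ < ‖f.denom.eval z₀‖) : ∃ G : Face f, G (f.val z₀) = z₀ := by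
  obtain ⟨G, hc, hm, he, hG⟩ := f.exists_lift_ball hz₀ hv
  have hlim : ∀ ζ ∈ closedBall (0 : ℂ) 1, ∃ y, Tendsto G (𝓝[ball 0 1] ζ) (𝓝 y) := by
    intro ζ hζ
    have hne : NeBot (𝓝[ball (0 : ℂ) 1] ζ) := by
      rw [← mem_closure_iff_nhdsWithin_neBot, closure_ball _ one_ne_zero]
      exact hζ
    suffices h : ∃ r ∈ closedBall (0 : ℂ) 1, Tendsto G (𝓝[ball 0 1] ζ) (𝓝 r) from
      ⟨h.choose, h.choose_spec.2⟩
    -- Cluster points of G at ζ solve num = ζ·denom, which leaves finitely many, and small convex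
    -- pieces of the disc near ζ have connected images.
    refine exists_tendsto_of_finite_mapClusterPt (l := 𝓝[ball (0 : ℂ) 1] ζ) (g := G)
      (isCompact_closedBall (0 : ℂ) 1)
      (eventually_mem_nhdsWithin.mono fun w hw => ball_subset_closedBall (hm hw))
      (f.finite_fiber ζ) ?_ ?_
    · intro r hr hcl
      have h1 : MapClusterPt (f.num.eval r - ζ * f.denom.eval r) (𝓝[ball (0 : ℂ) 1] ζ)
          ((fun z => f.num.eval z - ζ * f.denom.eval z) ∘ G) :=
        hcl.continuousAt_comp (f := fun z => f.num.eval z - ζ * f.denom.eval z)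
          (f.num.continuous.sub (continuous_const.mul f.denom.continuous)).continuousAt
      obtain ⟨M, hM⟩ := (isCompact_closedBall (0 : ℂ) 1).exists_bound_of_continuousOn
        (f := fun z => f.denom.eval z) f.denom.continuous.continuousOn
      have h2 : Tendsto ((fun z => f.num.eval z - ζ * f.denom.eval z) ∘ G) (𝓝[ball (0 : ℂ) 1] ζ)
          (𝓝 0) := by
        have h3 : Tendsto (fun w => ‖w - ζ‖ * M) (𝓝[ball (0 : ℂ) 1] ζ) (𝓝 0) := by
          have : Tendsto (fun w => ‖w - ζ‖ * M) (𝓝 ζ) (𝓝 (‖ζ - ζ‖ * M)) :=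
            Continuous.tendsto (by fun_prop) ζ
          simp only [sub_self, norm_zero, zero_mul] at this
          exact this.mono_left nhdsWithin_le_nhds
        refine squeeze_zero_norm' ?_ h3
        filter_upwards [self_mem_nhdsWithin] with w hw
        simp only [Function.comp]
        rw [he w hw, ← sub_mul, norm_mul]
        exact mul_le_mul_of_nonneg_left (hM _ (ball_subset_closedBall (hm hw))) (norm_nonneg _)
      have h4 : ClusterPt (f.num.eval r - ζ * f.denom.eval r) (𝓝 0) := ClusterPt.mono h1 h2
      have h5 := eq_of_nhds_neBot h4
      exact sub_eq_zero.1 h5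
    · intro s hs
      obtain ⟨ε, hε, hεs⟩ := mem_nhdsWithin_iff.1 hs
      refine ⟨ball ζ ε ∩ ball 0 1, inter_mem (mem_nhdsWithin_of_mem_nhds (ball_mem_nhds ζ hε)) self_mem_nhdsWithin, hεs, ?_⟩
      exact (((convex_ball ζ ε).inter (convex_ball 0 1)).isPreconnected).image G
        (hc.mono inter_subset_right)
  have hext : ContinuousOn (extendFrom (ball (0 : ℂ) 1) G) (closedBall 0 1) :=
    continuousOn_extendFrom (closure_ball (0 : ℂ) one_ne_zero).ge hlim
  have hin : ∀ w ∈ ball (0 : ℂ) 1, extendFrom (ball (0 : ℂ) 1) G w = G w :=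
    fun w hw => extendFrom_eq (subset_closure hw) (hc w hw)
  classical
  have heq : ∀ w ∈ closedBall (0 : ℂ) 1,
      (if w ∈ closedBall (0 : ℂ) 1 then extendFrom (ball (0 : ℂ) 1) G w else 0) =
        extendFrom (ball (0 : ℂ) 1) G w := fun w hw => by simp only [hw, if_true]
  refine ⟨⟨fun w => if w ∈ closedBall (0 : ℂ) 1 then extendFrom (ball (0 : ℂ) 1) G w else 0,
    hext.congr heq, fun w hw => ?_, fun w hw => ?_, fun w hw => by simp only [hw, if_false]⟩, ?_⟩
  · simp only [ball_subset_closedBall hw, if_true, hin w hw]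
    exact hm hw
  · simp only [heq w hw]
    have h1 : EqOn (fun w => f.num.eval (extendFrom (ball (0 : ℂ) 1) G w))
        (fun w => w * f.denom.eval (extendFrom (ball (0 : ℂ) 1) G w)) (closedBall 0 1) := by
      refine EqOn.of_subset_closure (s := ball 0 1) (fun w hw => ?_) ?_ ?_ ball_subset_closedBall
        (closure_ball (0 : ℂ) one_ne_zero).ge
      · simp only [hin w hw, he w hw]
      · exact f.num.continuous.comp_continuousOn hext
      · exact continuousOn_id.mul (f.denom.continuous.comp_continuousOn hext)
    exact h1 hw
  · have hd : f.denom.eval z₀ ≠ 0 := by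
      simpa using (norm_nonneg _).trans_lt hv
    have h1 : f.val z₀ ∈ ball (0 : ℂ) 1 := by
      rw [mem_ball_zero_iff, val, norm_div, div_lt_one (by simpa using hd)]
      exact hv
    change (if f.val z₀ ∈ closedBall (0 : ℂ) 1 then extendFrom (ball (0 : ℂ) 1) G (f.val z₀) else 0) = z₀
    rw [heq _ (ball_subset_closedBall h1), hin _ h1, hG]

namespace Face

variable {f} (G : Face f)

lemma mapsTo_closedBall : MapsTo G (closedBall 0 1) (closedBall 0 1) := by
  have := G.maps.closure_of_continuousOn (by rw [closure_ball _ one_ne_zero]; exact G.cont)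
  rwa [closure_ball _ one_ne_zero] at this

lemma denom_ne_zero {w : ℂ} (hw : w ∈ closedBall (0 : ℂ) 1) : f.denom.eval (G w) ≠ 0 :=
  f.denom_ne_zero_of_eq (G.eqn w hw)

lemma val_apply {w : ℂ} (hw : w ∈ closedBall (0 : ℂ) 1) : f.val (G w) = w :=
  (f.val_eq_iff (G.denom_ne_zero hw)).2 (G.eqn w hw)

lemma injOn : InjOn G (closedBall 0 1) := fun w hw w' hw' h => by
  rw [← G.val_apply hw, h, G.val_apply hw']

lemma eventually_eq_of_apply_eq {G G' : Face f} {w : ℂ} (hw : w ∈ closedBall (0 : ℂ) 1)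
    (h : G w = G' w) (hW : f.W.eval (G w) ≠ 0) :
    ∀ᶠ y in 𝓝[closedBall 0 1] w, G y = G' y := by
  obtain ⟨N, hN, hinj⟩ := f.exists_injOn_nhds (G.denom_ne_zero hw) hW
  filter_upwards [G.cont w hw hN, G'.cont w hw (h ▸ hN), self_mem_nhdsWithin] with y h1 h2 h3
  exact hinj h1 h2 (by rw [G.val_apply h3, G'.val_apply h3])

/-- Two inverse branches that agree at a point, where their value is not critical, are equal. -/
lemma eq_of_apply_eq {G G' : Face f} {w : ℂ} (hw : w ∈ closedBall (0 : ℂ) 1) (h : G w = G' w)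
    (hW : f.W.eval (G w) ≠ 0) : G = G' := by
  have h1 := eventually_eq_of_apply_eq hw h hW
  have hne : NeBot (𝓝[ball (0 : ℂ) 1] w) := by
    rw [← mem_closure_iff_nhdsWithin_neBot, closure_ball _ one_ne_zero]
    exact hw
  obtain ⟨x, hx, hxb⟩ := ((h1.filter_mono (nhdsWithin_mono w ball_subset_closedBall)).and
    self_mem_nhdsWithin).exists
  have h2 : EqOn G G' (ball 0 1) :=
    (convex_ball (0 : ℂ) 1).isPreconnected.eqOn_of_eventually_eq
      (G.cont.mono ball_subset_closedBall) (G'.cont.mono ball_subset_closedBall)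
      (fun y hy hyG => (eventually_eq_of_apply_eq (ball_subset_closedBall hy) hyG
        (f.W_ne_zero_of_mem_ball (G.maps hy))).filter_mono (nhdsWithin_mono y ball_subset_closedBall))
      hxb hx
  have h3 : EqOn G G' (closedBall 0 1) :=
    h2.of_subset_closure G.cont G'.cont ball_subset_closedBall
      (closure_ball (0 : ℂ) one_ne_zero).ge
  ext y
  by_cases hy : y ∈ closedBall (0 : ℂ) 1
  · exact h3 hy
  -- The fixed value 0 off the closed disc makes a face determined by its branch.
  · rw [G.outside y hy, G'.outside y hy]

/-- A branch is determined by its value at 0, a point of the finite fibre over 0. Finiteness keeps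
unions of closed face images or angle sets closed. -/
instance : Finite (Face f) := by
  have : Finite {z | f.num.eval z = 0 * f.denom.eval z} := f.finite_fiber 0
  have h0 : (0 : ℂ) ∈ ball (0 : ℂ) 1 := by simp
  refine Finite.of_injective (β := {z | f.num.eval z = 0 * f.denom.eval z})
    (fun G => ⟨G 0, G.eqn 0 (ball_subset_closedBall h0)⟩) fun G G' h => ?_
  exact eq_of_apply_eq (ball_subset_closedBall h0) (congrArg Subtype.val h)
    (f.W_ne_zero_of_mem_ball (G.maps h0))

lemma hasStrictDerivAt {w : ℂ} (hw : w ∈ ball (0 : ℂ) 1) :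
    ∃ g' ≠ 0, HasStrictDerivAt G g' w := by
  have hd := G.denom_ne_zero (ball_subset_closedBall hw)
  have hne : f.W.eval (G w) / f.denom.eval (G w) ^ 2 ≠ 0 :=
    div_ne_zero (f.W_ne_zero_of_mem_ball (G.maps hw)) (pow_ne_zero 2 hd)
  refine ⟨_, inv_ne_zero hne, (f.hasStrictDerivAt_val hd).of_local_left_inverse ?_ hne ?_⟩
  · exact (G.cont.mono ball_subset_closedBall).continuousAt (isOpen_ball.mem_nhds hw)
  · filter_upwards [isOpen_ball.mem_nhds hw] with y hy
    exact G.val_apply (ball_subset_closedBall hy)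

end Face

/-- The closures of the components of the complement of the net cover the closed disc. -/
lemma exists_face_of_mem_closure {z : ℂ}
    (hz : z ∈ closure {z : ℂ | ‖z‖ < 1 ∧ ‖f.num.eval z‖ < ‖f.denom.eval z‖}) :
    ∃ G : Face f, ∃ w ∈ closedBall (0 : ℂ) 1, G w = z := by
  have hcl : IsClosed (⋃ G : Face f, G '' closedBall 0 1) :=
    isClosed_iUnion_of_finite fun G =>
      ((isCompact_closedBall (0 : ℂ) 1).image_of_continuousOn G.cont).isClosed
  have hsub : {z : ℂ | ‖z‖ < 1 ∧ ‖f.num.eval z‖ < ‖f.denom.eval z‖} ⊆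
      ⋃ G : Face f, G '' closedBall 0 1 := by
    intro z hz
    obtain ⟨G, hG⟩ := f.exists_face_of_norm_lt hz.1 hz.2
    refine mem_iUnion.2 ⟨G, f.val z, ?_, hG⟩
    have hd : f.denom.eval z ≠ 0 := by
      simpa using (norm_nonneg _).trans_lt hz.2
    rw [mem_closedBall_zero_iff, val, norm_div, div_le_one (by simpa using hd)]
    exact hz.2.le
  obtain ⟨G, w, hw, hwz⟩ := mem_iUnion.1 (closure_minimal hsub hcl hz)
  exact ⟨G, w, hw, hwz⟩

end CircleRatFun

/-! ### Boundary rotation of an injective self-map of the disc -/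

/-- The pairs of points of the closed unit disc, without the diagonal of the unit circle. -/
def discPairs : Set (ℂ × ℂ) := {q | ‖q.1‖ ≤ 1 ∧ ‖q.2‖ ≤ 1 ∧ (q.1 = q.2 → ‖q.1‖ < 1)}

lemma eq_of_norm_combo_eq_one {z w : ℂ} (hz : ‖z‖ ≤ 1) (hw : ‖w‖ ≤ 1) {a b : ℝ} (ha : 0 < a)
    (hb : 0 < b) (hab : a + b = 1) (h : ‖a • z + b • w‖ = 1) : z = w := by
  by_contra hne
  have := norm_combo_lt_of_ne hz hw hne ha hb hab
  linarith

/-- By strict convexity of the disc, a pair on the removed diagonal can only be a combination of two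
copies of itself. Convexity supplies the contractibility needed to lift through `exp`. -/
lemma convex_discPairs : Convex ℝ discPairs := by
  rw [convex_iff_forall_pos]
  rintro ⟨z, w⟩ ⟨hz, hw, hzw⟩ ⟨z', w'⟩ ⟨hz', hw', hzw'⟩ a b ha hb hab
  have key (u v : ℂ) (hu : ‖u‖ ≤ 1) (hv : ‖v‖ ≤ 1) : ‖a • u + b • v‖ ≤ 1 := by
    have := (convex_closedBall (0 : ℂ) 1) (mem_closedBall_zero_iff.2 hu)
      (mem_closedBall_zero_iff.2 hv) ha.le hb.le hab
    simpa using this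
  refine ⟨key _ _ hz hz', key _ _ hw hw', fun h => lt_of_le_of_ne (key _ _ hz hz') fun h1 => ?_⟩
  simp only [Prod.smul_mk, Prod.mk_add_mk] at h h1
  have e1 : z = z' := eq_of_norm_combo_eq_one hz hz' ha hb hab h1
  have e2 : w = w' := eq_of_norm_combo_eq_one hw hw' ha hb hab (h ▸ h1)
  subst e1 e2
  rw [← add_smul, ← add_smul, hab, one_smul, one_smul] at h
  rw [← add_smul, hab, one_smul] at h1
  have := hzw h
  simp only at this
  linarith

/-- A point of the circle is an extreme point of the closed disc. The set is the connected domain on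
which a logarithm is later shown to be constant. -/
lemma convex_closedBall_diff_singleton {w : ℂ} (hw : ‖w‖ = 1) :
    Convex ℝ (closedBall (0 : ℂ) 1 \ {w}) := by
  rw [convex_iff_forall_pos]
  rintro z ⟨hz, hzw⟩ z' ⟨hz', hzw'⟩ a b ha hb hab
  refine ⟨(convex_closedBall (0 : ℂ) 1) hz hz' ha.le hb.le hab, fun h => ?_⟩
  rw [mem_singleton_iff] at h
  have e1 : z = z' := eq_of_norm_combo_eq_one (by simpa using hz) (by simpa using hz') ha hb hab
    (by rw [h, hw])
  subst e1
  rw [← add_smul, hab, one_smul] at h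
  exact hzw h

/-- The difference quotient of an injective holomorphic function on the disc that is continuous
on the closed disc has a continuous symmetric logarithm. -/
lemma exists_log_slope {G : ℂ → ℂ} (hc : ContinuousOn G (closedBall 0 1))
    (hinj : InjOn G (closedBall 0 1))
    (hd : ∀ w ∈ ball (0 : ℂ) 1, ∃ g' ≠ 0, HasStrictDerivAt G g' w) :
    ∃ A : ℂ × ℂ → ℂ, ContinuousOn A discPairs ∧
      (∀ q ∈ discPairs, q.1 ≠ q.2 → Complex.exp (A q) * (q.1 - q.2) = G q.1 - G q.2) ∧
      ∀ q ∈ discPairs, A q.swap = A q := by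
  classical
  -- The slope, continued by the derivative to the diagonal of the open disc. Injectivity and the
  -- nonzero derivative keep it away from 0; strict differentiability makes it continuous at the
  -- diagonal.
  let Q : ℂ × ℂ → ℂ := fun q => if q.1 = q.2 then deriv G q.1 else (G q.1 - G q.2) / (q.1 - q.2)
  have hswap (q : ℂ × ℂ) : Q q.swap = Q q := by
    simp only [Q, Prod.fst_swap, Prod.snd_swap]
    by_cases h : q.1 = q.2
    · simp [h]
    · rw [if_neg h, if_neg (Ne.symm h), ← neg_sub, ← neg_sub q.1, neg_div_neg_eq]
  have hswapmem (q : ℂ × ℂ) (hq : q ∈ discPairs) : q.swap ∈ discPairs :=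
    ⟨hq.2.1, hq.1, fun h => by
      have h' : q.2 = q.1 := h
      have := hq.2.2 h'.symm
      simpa [h'] using this⟩
  have hQ0 (q : ℂ × ℂ) (hq : q ∈ discPairs) : Q q ∈ ({0}ᶜ : Set ℂ) := by
    simp only [Q, mem_compl_iff, mem_singleton_iff]
    by_cases h : q.1 = q.2
    · rw [if_pos h]
      obtain ⟨g', hg', hG⟩ := hd q.1 (mem_ball_zero_iff.2 (hq.2.2 h))
      rwa [hG.hasDerivAt.deriv]
    · rw [if_neg h]
      refine div_ne_zero (sub_ne_zero.2 fun h1 => h ?_) (sub_ne_zero.2 h)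
      exact hinj (mem_closedBall_zero_iff.2 hq.1) (mem_closedBall_zero_iff.2 hq.2.1) h1
  have hQc : ContinuousOn Q discPairs := by
    intro q hq
    by_cases h : q.1 = q.2
    · obtain ⟨g', hg', hG⟩ := hd q.1 (mem_ball_zero_iff.2 (hq.2.2 h))
      obtain ⟨z, w⟩ := q
      simp only at h hG
      subst h
      have hz : z ∈ ball (0 : ℂ) 1 := mem_ball_zero_iff.2 (hq.2.2 rfl)
      have hdiff : DifferentiableOn ℂ G (ball 0 1) := fun y hy => by
        obtain ⟨g', -, hG⟩ := hd y hy
        exact hG.hasDerivAt.differentiableAt.differentiableWithinAt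
      have hdc : ContinuousAt (fun q : ℂ × ℂ => deriv G q.1) (z, z) := by
        have := ((hdiff.deriv isOpen_ball).continuousOn).continuousAt (isOpen_ball.mem_nhds hz)
        exact ContinuousAt.comp (f := Prod.fst) (x := (z, z)) this continuousAt_fst
      refine ContinuousAt.continuousWithinAt (Metric.tendsto_nhds.2 fun ε hε => ?_)
      have h1 := hG.hasStrictFDerivAt.isLittleO.def (half_pos hε)
      filter_upwards [h1, Metric.tendsto_nhds.1 hdc ε hε] with p hp1 hp2
      have hQz : Q (z, z) = g' := by simp only [Q, if_true, hG.hasDerivAt.deriv]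
      by_cases hp : p.1 = p.2
      · simpa only [Q, hp, if_true] using hp2
      · have hp0 : p.1 - p.2 ≠ 0 := sub_ne_zero.2 hp
        have e : Q p - g' = (G p.1 - G p.2 - (p.1 - p.2) * g') / (p.1 - p.2) := by
          simp only [Q, if_neg hp]
          field_simp
        rw [hQz, dist_eq_norm, e, norm_div, div_lt_iff₀ (norm_pos_iff.2 hp0)]
        have h2 : ‖G p.1 - G p.2 - (p.1 - p.2) * g'‖ ≤ ε / 2 * ‖p.1 - p.2‖ := by simpa using hp1
        have := norm_pos_iff.2 hp0
        nlinarith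
    · have h1 : ContinuousWithinAt (fun q : ℂ × ℂ => (G q.1 - G q.2) / (q.1 - q.2)) discPairs q := by
        refine ContinuousWithinAt.div (ContinuousWithinAt.sub ?_ ?_)
          (continuous_fst.sub continuous_snd).continuousWithinAt (sub_ne_zero.2 h)
        · exact (hc _ (mem_closedBall_zero_iff.2 hq.1)).comp continuous_fst.continuousWithinAt
            fun p hp => mem_closedBall_zero_iff.2 hp.1
        · exact (hc _ (mem_closedBall_zero_iff.2 hq.2.1)).comp continuous_snd.continuousWithinAt
            fun p hp => mem_closedBall_zero_iff.2 hp.2.1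
      refine h1.congr_of_eventuallyEq ?_ (if_neg h)
      have : ∀ᶠ p : ℂ × ℂ in 𝓝 q, p.1 ≠ p.2 :=
        (isOpen_ne_fun continuous_fst continuous_snd).mem_nhds h
      filter_upwards [nhdsWithin_le_nhds this] with p hp
      exact if_neg hp
  have h0 : ((0 : ℂ), (0 : ℂ)) ∈ discPairs := by simp [discPairs]
  have : ContractibleSpace discPairs := convex_discPairs.contractibleSpace ⟨_, h0⟩
  have : LocallyPathConnectedSpace discPairs := convex_discPairs.locallyPathConnectedSpace
  obtain ⟨A, ⟨hA0, hA⟩, huniq⟩ := Complex.isCoveringMapOn_exp.existsUnique_continuousMap_lifts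
    (⟨discPairs.domRestrict Q, continuousOn_iff_continuous_domRestrict.1 hQc⟩ : C(discPairs, ℂ))
    (a₀ := ⟨_, h0⟩) (e₀ := Complex.log (Q (0, 0))) (Complex.exp_log (hQ0 _ h0)) (fun a => hQ0 _ a.2)
  let s : C(discPairs, discPairs) := ⟨fun q => ⟨q.1.swap, hswapmem _ q.2⟩, by
    exact (continuous_swap.comp continuous_subtype_val).subtype_mk _⟩
  -- Swapping the coordinates preserves Q and fixes the base point (0, 0), so uniqueness of lifts
  -- gives the symmetry.
  have hAs : A.comp s = A := huniq _ ⟨hA0, by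
    ext q
    have := congrFun hA (s q)
    simp only [Function.comp, ContinuousMap.comp_apply] at this ⊢
    rw [this]
    exact hswap q⟩
  refine ⟨fun q => if h : q ∈ discPairs then A ⟨q, h⟩ else 0, ?_, ?_, ?_⟩
  · rw [continuousOn_iff_continuous_domRestrict]
    refine A.continuous.congr fun q => ?_
    simp only [domRestrict_apply, q.2, dite_true]
  · intro q hq h
    simp only [hq, dite_true]
    have h1 : Complex.exp (A ⟨q, hq⟩) = Q q := congrFun hA ⟨q, hq⟩
    rw [h1]
    simp only [Q, if_neg h]
    exact div_mul_cancel₀ _ (sub_ne_zero.2 h)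
  · intro q hq
    simp only [hq, hswapmem q hq, dite_true]
    exact DFunLike.congr_fun hAs ⟨q, hq⟩

/-- The positive real part makes the principal logarithm continuous and bounds the argument by π/2;
that bound is the source of the open range (0, 2π) in `Face.exists_argument`. -/
lemma one_sub_mul_conj_re_pos {z w : ℂ} (hz : ‖z‖ ≤ 1) (hw : ‖w‖ = 1) (h : z ≠ w) :
    0 < (1 - z * conj w).re := by
  have h1 : ‖z * conj w‖ ≤ 1 := by rw [norm_mul, Complex.norm_conj, hw, mul_one]; exact hz
  have h2 : (z * conj w).re ≤ 1 := (Complex.re_le_norm _).trans h1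
  rw [Complex.sub_re, Complex.one_re, sub_pos]
  refine lt_of_le_of_ne h2 fun h3 => h ?_
  have h4 : z * conj w = 1 := by
    have h5 : ‖z * conj w‖ = 1 := le_antisymm h1 (h3 ▸ Complex.re_le_norm _)
    have h6 : (z * conj w).im = 0 := by
      have := Complex.sq_norm_sub_sq_re (z * conj w)
      rw [h5, h3] at this
      have h7 : (z * conj w).im ^ 2 = 0 := by linarith
      exact pow_eq_zero_iff two_ne_zero |>.1 h7
    exact Complex.ext h3 (by simpa using h6)
  have h5 : conj w * w = 1 := by rw [Complex.conj_mul', hw]; simp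
  calc z = z * (conj w * w) := by rw [h5, mul_one]
    _ = w := by rw [← mul_assoc, h4, one_mul]

lemma one_sub_mem_slitPlane {z w : ℂ} (hz : ‖z‖ ≤ 1) (hw : ‖w‖ = 1) (h : z ≠ w) :
    1 - z * conj w ∈ Complex.slitPlane := Or.inl (one_sub_mul_conj_re_pos hz hw h)

/-- Boundary rotation of an injective holomorphic self-map of the disc: the angles of the boundary
points with values on the unit circle move in a monotone way. -/
lemma exists_boundary_rotation {G : ℂ → ℂ} (hc : ContinuousOn G (closedBall 0 1))
    (hinj : InjOn G (closedBall 0 1)) (hm : MapsTo G (closedBall 0 1) (closedBall 0 1))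
    (hd : ∀ w ∈ ball (0 : ℂ) 1, ∃ g' ≠ 0, HasStrictDerivAt G g' w) :
    ∃ c : ℂ → ℂ, (∀ w, ‖w‖ = 1 → ‖G w‖ = 1 → Complex.exp (c w) = G w / w) ∧
      ∀ z w, ‖z‖ = 1 → ‖w‖ = 1 → ‖G z‖ = 1 → ‖G w‖ = 1 → z ≠ w →
        (c z).im - (c w).im =
          2 * ((1 - G z * conj (G w)).arg - (1 - z * conj w).arg) := by
  obtain ⟨A, hAc, hAe, hAs⟩ := exists_log_slope hc hinj hd
  -- For |w| = |G w| = 1 the quotient (1 − z w̄)/(1 − G z · conj (G w)) equals (z − w)/(G z − G w) ·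
  -- G w / w, so exp (D w z) = G w / w does not depend on z.
  let D (w z : ℂ) : ℂ := A (z, w) - Complex.log (1 - G z * conj (G w)) +
    Complex.log (1 - z * conj w)
  have hmem {z w : ℂ} (hz : ‖z‖ ≤ 1) (hw : ‖w‖ = 1) (h : z ≠ w) : (z, w) ∈ discPairs :=
    ⟨hz, hw.le, fun h' => (h h').elim⟩
  have hGne {z w : ℂ} (hz : ‖z‖ ≤ 1) (hw : ‖w‖ = 1) (h : z ≠ w) : G z ≠ G w := fun h' =>
    h (hinj (mem_closedBall_zero_iff.2 hz) (mem_closedBall_zero_iff.2 hw.le) h')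
  have hGm {z : ℂ} (hz : ‖z‖ ≤ 1) : ‖G z‖ ≤ 1 :=
    mem_closedBall_zero_iff.1 (hm (mem_closedBall_zero_iff.2 hz))
  have hexp {z w : ℂ} (hz : ‖z‖ ≤ 1) (hw : ‖w‖ = 1) (hGw : ‖G w‖ = 1) (h : z ≠ w) :
      Complex.exp (D w z) = G w / w := by
    have s1 := one_sub_mem_slitPlane (hGm hz) hGw (hGne hz hw h)
    have s2 := one_sub_mem_slitPlane hz hw h
    have e1 := hAe _ (hmem hz hw h) h
    simp only at e1
    simp only [D]
    have hw0 : w ≠ 0 := by rintro rfl; simp at hw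
    have hG1 : conj (G w) * G w = 1 := by rw [Complex.conj_mul', hGw]; simp
    have hw1 : conj w * w = 1 := by rw [Complex.conj_mul', hw]; simp
    rw [Complex.exp_add, Complex.exp_sub, Complex.exp_log (Complex.slitPlane_ne_zero s1),
      Complex.exp_log (Complex.slitPlane_ne_zero s2), div_mul_eq_mul_div,
      div_eq_div_iff (Complex.slitPlane_ne_zero s1) hw0]
    linear_combination -e1 + z * Complex.exp (A (z, w)) * (-hw1) + G z * hG1
  have hconst {z w : ℂ} (hz : ‖z‖ ≤ 1) (hw : ‖w‖ = 1) (hGw : ‖G w‖ = 1) (h : z ≠ w) :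
      D w z = D w 0 := by
    have hcont : ContinuousOn (D w) (closedBall 0 1 \ {w}) := by
      have hG' : ContinuousOn G (closedBall 0 1 \ {w}) := hc.mono sdiff_subset
      refine ContinuousOn.add (ContinuousOn.sub ?_ (ContinuousOn.clog ?_ ?_))
        (ContinuousOn.clog ?_ ?_)
      · refine hAc.comp (Continuous.continuousOn (by fun_prop)) fun u hu => ?_
        exact hmem (by simpa using hu.1) hw (by simpa using hu.2)
      · exact continuousOn_const.sub (hG'.mul continuousOn_const)
      · intro u hu
        have hu1 : ‖u‖ ≤ 1 := by simpa using hu.1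
        exact one_sub_mem_slitPlane (hGm hu1) hGw (hGne hu1 hw (by simpa using hu.2))
      · fun_prop
      · intro u hu
        exact one_sub_mem_slitPlane (by simpa using hu.1) hw (by simpa using hu.2)
    have hw0 : w ≠ 0 := by rintro rfl; simp at hw
    -- A continuous lift of a constant through `exp` over a connected set is constant.
    refine Complex.isCoveringMap_exp.constOn_of_comp
      (convex_closedBall_diff_singleton hw).isPreconnected hcont ?_ ⟨by simpa using hz, h⟩
      ⟨by simp, hw0.symm⟩
    intro u hu v hv
    apply Subtype.ext
    simp only
    rw [hexp (by simpa using hu.1) hw hGw (by simpa using hu.2),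
      hexp (by simpa using hv.1) hw hGw (by simpa using hv.2)]
  refine ⟨fun w => D w 0, fun w hw hGw => hexp (by simp) hw hGw ?_, fun z w hz hw hGz hGw h => ?_⟩
  · rintro rfl; simp at hw
  · simp only
    -- Compare D w at z with D z at w: the symmetric term A cancels, and the remaining logarithms
    -- are conjugate, so their imaginary parts double.
    rw [← hconst hz.le hw hGw h, ← hconst hw.le hz hGz h.symm]
    have h1 := hAs _ (hmem hz.le hw h)
    simp only [Prod.swap_prod_mk] at h1
    simp only [D]
    rw [h1]
    have e1 : 1 - w * conj z = conj (1 - z * conj w) := by simp [mul_comm]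
    have e2 : 1 - G w * conj (G z) = conj (1 - G z * conj (G w)) := by simp [mul_comm]
    have s1 := one_sub_mem_slitPlane (hGm hz.le) hGw (hGne hz.le hw h)
    have s2 := one_sub_mem_slitPlane hz.le hw h
    rw [e1, e2, Complex.log_conj _ (Complex.slitPlane_arg_ne_pi s1),
      Complex.log_conj _ (Complex.slitPlane_arg_ne_pi s2)]
    simp only [Complex.add_im, Complex.sub_im, Complex.conj_im, Complex.log_im]
    ring

/-! ### Angles on the unit circle -/

/-- 1 − e^{ix} = 2 sin(x/2) e^{i(x−π)/2}, and the sine is positive in this range. -/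
lemma arg_one_sub_circlePt {x : ℝ} (h0 : 0 < x) (h1 : x < 2 * Real.pi) :
    (1 - circlePt x).arg = (x - Real.pi) / 2 := by
  have : 1 - circlePt x = ((2 * Real.sin (x / 2) : ℝ) : ℂ) *
      Complex.exp (((x - Real.pi) / 2 : ℝ) * Complex.I) := by
    have hx : (x - Real.pi) / 2 = x / 2 - Real.pi / 2 := by ring
    have hx2 : x = 2 * (x / 2) := by ring
    apply Complex.ext
    · simp only [circlePt, Complex.sub_re, Complex.one_re, Complex.re_ofReal_mul,
        Complex.exp_ofReal_mul_I_re, hx, Real.cos_sub_pi_div_two]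
      conv_lhs => rw [hx2, Real.cos_two_mul']
      linear_combination -Real.sin_sq_add_cos_sq (x / 2)
    · simp only [circlePt, Complex.sub_im, Complex.one_im, Complex.im_ofReal_mul,
        Complex.exp_ofReal_mul_I_im, hx, Real.sin_sub_pi_div_two]
      conv_lhs => rw [hx2, Real.sin_two_mul]
      ring
  rw [this, Complex.arg_real_mul _ (by
    have := Real.sin_pos_of_pos_of_lt_pi (x := x / 2) (by linarith) (by linarith)
    positivity), Complex.arg_exp_mul_I, toIocMod_eq_self]
  constructor <;> linarith [Real.pi_pos]

lemma norm_circlePt (t : ℝ) : ‖circlePt t‖ = 1 := Complex.norm_exp_ofReal_mul_I t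

lemma circlePt_ne_zero (t : ℝ) : circlePt t ≠ 0 := Complex.exp_ne_zero _

lemma circlePt_add (s t : ℝ) : circlePt (s + t) = circlePt s * circlePt t := by
  simp [circlePt, add_mul, Complex.exp_add]

lemma circlePt_neg (t : ℝ) : circlePt (-t) = (circlePt t)⁻¹ := by
  simp [circlePt, Complex.exp_neg]

lemma conj_circlePt (t : ℝ) : conj (circlePt t) = circlePt (-t) := by
  rw [circlePt_neg, Complex.inv_eq_conj (norm_circlePt t)]

lemma circlePt_sub (s t : ℝ) : circlePt (s - t) = circlePt s / circlePt t := by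
  rw [sub_eq_add_neg, circlePt_add, circlePt_neg, div_eq_mul_inv]

lemma circlePt_add_two_pi (t : ℝ) : circlePt (t + 2 * Real.pi) = circlePt t := by
  simp [circlePt, add_mul, Complex.exp_add]

lemma circlePt_eq_iff {s t : ℝ} : circlePt s = circlePt t ↔ ∃ k : ℤ, s = t + k * (2 * Real.pi) := by
  rw [circlePt, circlePt, Complex.exp_eq_exp_iff_exists_int]
  refine exists_congr fun k => ?_
  constructor
  · intro h
    have := congrArg Complex.im h
    simpa using this
  · rintro rfl
    push_cast
    ring

lemma circlePt_ne {s t : ℝ} (h : s < t) (h' : t < s + 2 * Real.pi) : circlePt t ≠ circlePt s := by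
  rw [Ne, circlePt_eq_iff]
  rintro ⟨k, hk⟩
  have h1 : (0 : ℝ) < k := by
    by_contra! hk0
    nlinarith [Real.pi_pos]
  have h2 : (1 : ℝ) ≤ k := by exact_mod_cast h1
  nlinarith [Real.pi_pos]

lemma exists_circlePt_eq {z : ℂ} (hz : ‖z‖ = 1) : ∃ t : ℝ, circlePt t = z :=
  ⟨z.arg, by
    have := Complex.norm_mul_exp_arg_mul_I z
    rwa [hz, Complex.ofReal_one, one_mul] at this⟩

lemma exists_circlePt_eq_Ico {z : ℂ} (hz : ‖z‖ = 1) (a : ℝ) :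
    ∃ t ∈ Ico a (a + 2 * Real.pi), circlePt t = z := by
  obtain ⟨t, rfl⟩ := exists_circlePt_eq hz
  refine ⟨toIcoMod Real.two_pi_pos a t, toIcoMod_mem_Ico _ _ _, circlePt_eq_iff.2
    ⟨-toIcoDiv Real.two_pi_pos a t, ?_⟩⟩
  have := toIcoMod_add_toIcoDiv_zsmul Real.two_pi_pos a t
  rw [zsmul_eq_mul] at this
  push_cast
  linarith

lemma continuous_circlePt : Continuous circlePt := by unfold circlePt; fun_prop

/-! ### Cyclic order on the boundary of a face -/

namespace CircleRatFun

variable {f : CircleRatFun}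

/-- The angles of the points of the unit circle on the boundary of a face. -/
def Face.angles (G : Face f) : Set ℝ := {t | ∃ ζ : ℂ, ‖ζ‖ = 1 ∧ G ζ = circlePt t}

lemma Face.mem_angles_iff {G : Face f} {t : ℝ} :
    t ∈ G.angles ↔ G (f.val (circlePt t)) = circlePt t := by
  constructor
  · rintro ⟨ζ, hζ, h⟩
    rw [← h, G.val_apply (mem_closedBall_zero_iff.2 hζ.le)]
  · exact fun h => ⟨_, f.norm_val_circle (norm_circlePt t), h⟩

lemma Face.add_two_pi_mem_angles {G : Face f} {t : ℝ} :
    t + 2 * Real.pi ∈ G.angles ↔ t ∈ G.angles := by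
  simp only [Face.angles, circlePt_add_two_pi, mem_ofPred_eq]

lemma Face.isClosed_angles (G : Face f) : IsClosed G.angles := by
  have h1 : IsClosed (G '' sphere 0 1) :=
    ((isCompact_sphere (0 : ℂ) 1).image_of_continuousOn
      (G.cont.mono sphere_subset_closedBall)).isClosed
  convert! h1.preimage continuous_circlePt using 1
  ext t
  simp [Face.angles]

/-- The boundary of a face passes through the points of the unit circle in their cyclic order. -/
lemma Face.exists_argument (G : Face f) : ∃ σ : ℝ → ℝ,
    (∀ t ∈ G.angles, circlePt (σ t) = f.val (circlePt t)) ∧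
    (∀ t ∈ G.angles, ∀ t' ∈ G.angles, t < t' → t' < t + 2 * Real.pi →
      σ t < σ t' ∧ σ t' < σ t + 2 * Real.pi) ∧
    ∀ t, σ (t + 2 * Real.pi) = σ t + 2 * Real.pi := by
  obtain ⟨c, hc1, hc2⟩ := exists_boundary_rotation G.cont G.injOn G.mapsTo_closedBall
    fun w hw => G.hasStrictDerivAt hw
  -- With w = f(e^{it}) one has exp (c w) = e^{it}/w, so t − Im (c w) is an argument of w. For two
  -- angles the rotation formula gives the increment π + 2 arg(1 − w' w̄), where the last argument
  -- is less than π/2 in absolute value.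
  refine ⟨fun t => t - (c (f.val (circlePt t))).im, fun t ht => ?_, fun t ht t' ht' h h' => ?_,
    fun t => ?_⟩
  · rw [mem_angles_iff] at ht
    have hn := f.norm_val_circle (norm_circlePt t)
    have h1 := hc1 _ hn (by rw [ht, norm_circlePt])
    rw [ht] at h1
    have h2 : circlePt (c (f.val (circlePt t))).im = circlePt t / f.val (circlePt t) := by
      have h3 := Complex.norm_exp (c (f.val (circlePt t)))
      rw [h1, norm_div, norm_circlePt, hn, div_one, eq_comm, Real.exp_eq_one_iff] at h3
      rw [← h1, circlePt]
      congr 1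
      apply Complex.ext <;> simp [h3]
    rw [circlePt_sub, h2]
    field_simp [circlePt_ne_zero t]
  · rw [mem_angles_iff] at ht ht'
    have hn := f.norm_val_circle (norm_circlePt t)
    have hn' := f.norm_val_circle (norm_circlePt t')
    have hne : f.val (circlePt t') ≠ f.val (circlePt t) := fun h1 =>
      circlePt_ne h h' (by rw [← ht, ← ht', h1])
    have h1 := hc2 _ _ hn' hn (by rw [ht', norm_circlePt]) (by rw [ht, norm_circlePt]) hne
    rw [ht, ht', conj_circlePt, ← circlePt_add, ← sub_eq_add_neg,
      arg_one_sub_circlePt (by linarith) (by linarith)] at h1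
    have h3 : |(1 - f.val (circlePt t') * conj (f.val (circlePt t))).arg| < Real.pi / 2 :=
      Complex.abs_arg_lt_pi_div_two_iff.2 (Or.inl (one_sub_mul_conj_re_pos hn'.le hn hne))
    rw [abs_lt] at h3
    constructor <;> linarith
  · simp only [circlePt_add_two_pi]
    ring

/-! ### Faces at a given point of the net or of the circle -/

variable (f)

lemma not_mem_vertices_iff {z : ℂ} : z ∉ f.vertices ↔ f.W.eval z ≠ 0 := Iff.rfl

lemma norm_val_lt_one_iff {z : ℂ} (hd : f.denom.eval z ≠ 0) :
    ‖f.val z‖ < 1 ↔ ‖f.num.eval z‖ < ‖f.denom.eval z‖ := by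
  rw [val, norm_div, div_lt_one (norm_pos_iff.2 hd)]

/-- Each point of the net inside the disc is on the boundary of a face. -/
lemma exists_face_of_norm_val_eq {z : ℂ} (hz : ‖z‖ < 1) (hv : ‖f.val z‖ = 1) :
    ∃ G : Face f, G (f.val z) = z := by
  have hd := f.denom_ne_zero_of_norm_val hv
  suffices h : z ∈ closure {z : ℂ | ‖z‖ < 1 ∧ ‖f.num.eval z‖ < ‖f.denom.eval z‖} by
    obtain ⟨G, w, hw, rfl⟩ := f.exists_face_of_mem_closure h
    exact ⟨G, by rw [G.val_apply hw]⟩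
  rw [mem_closure_iff_frequently]
  have hW := f.W_ne_zero_of_mem_ball (mem_ball_zero_iff.2 hz)
  -- f is open at z and f(z) is a limit of points of the disc, so points with |f| < 1 occur
  -- arbitrarily close to z.
  have h1 := (f.hasStrictDerivAt_val hd).map_nhds_eq (div_ne_zero hW (pow_ne_zero 2 hd))
  have h2 : ∃ᶠ w in 𝓝 (f.val z), ‖w‖ < 1 := by
    have : f.val z ∈ closure (ball (0 : ℂ) 1) := by
      rw [closure_ball _ one_ne_zero]; simp [hv]
    simpa using mem_closure_iff_frequently.1 this
  rw [← h1, frequently_map] at h2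
  have h3 : ∀ᶠ w in 𝓝 z, f.denom.eval w ≠ 0 :=
    f.denom.continuous.continuousAt.eventually_ne hd
  have h4 : ∀ᶠ w in 𝓝 z, ‖w‖ < 1 := continuous_norm.continuousAt.eventually_lt_const hz
  refine (h2.and_eventually (h3.and h4)).mono fun w hw => ⟨hw.2.2, ?_⟩
  exact (f.norm_val_lt_one_iff hw.2.1).1 hw.1

/-- A point of the circle that is not critical is on the boundary of a face inside the disc, of
one of the two kinds. -/
lemma exists_face_of_norm_eq {z : ℂ} (hz : ‖z‖ = 1) (hW : f.W.eval z ≠ 0) :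
    (∃ G : Face f, G (f.val z) = z) ∨ ∃ H : Face f.swap, H (f.swap.val z) = z := by
  have hz0 : ∃ᶠ w in 𝓝 z, ‖w‖ < 1 := by
    have : z ∈ closure (ball (0 : ℂ) 1) := by
      rw [closure_ball _ one_ne_zero]; simp [hz]
    simpa using mem_closure_iff_frequently.1 this
  have h3 : ∀ᶠ w in 𝓝 z, f.denom.eval w ≠ 0 :=
    f.denom.continuous.continuousAt.eventually_ne (f.denom_ne_zero_of_norm hz)
  -- Near z every point of the disc has |f| < 1 or |f| > 1, so at least one of the two kinds
  -- accumulates at z.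
  have h4 := f.eventually_norm_val_ne_one hz hW
  have h5 : ∃ᶠ w in 𝓝 z, (‖w‖ < 1 ∧ ‖f.num.eval w‖ < ‖f.denom.eval w‖) ∨
      (‖w‖ < 1 ∧ ‖f.denom.eval w‖ < ‖f.num.eval w‖) := by
    refine (hz0.and_eventually (h3.and h4)).mono fun w hw => ?_
    have h6 := hw.2.2 hw.1
    rw [val, norm_div, Ne, div_eq_one_iff_eq (norm_ne_zero_iff.2 hw.2.1)] at h6
    rcases lt_or_gt_of_ne h6 with h | h
    · exact Or.inl ⟨hw.1, h⟩
    · exact Or.inr ⟨hw.1, h⟩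
  rcases frequently_or_distrib.1 h5 with h | h
  · left
    obtain ⟨G, w, hw, rfl⟩ := f.exists_face_of_mem_closure (mem_closure_iff_frequently.2 h)
    exact ⟨G, by rw [G.val_apply hw]⟩
  · right
    obtain ⟨G, w, hw, rfl⟩ := f.swap.exists_face_of_mem_closure (mem_closure_iff_frequently.2 h)
    exact ⟨G, by rw [G.val_apply hw]⟩

variable {f}

/-- The point outside the disc that is symmetric to a point of a face of `1 / f`. -/
lemma Face.reflect (H : Face f.swap) {w : ℂ} (hw : w ∈ ball (0 : ℂ) 1) (h0 : H (conj w) ≠ 0) :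
    1 < ‖(conj (H (conj w)))⁻¹‖ ∧ f.val (conj (H (conj w)))⁻¹ = w := by
  have hw' : conj w ∈ ball (0 : ℂ) 1 := by simpa using hw
  have h1 := H.maps hw'
  have h2 := H.denom_ne_zero (ball_subset_closedBall hw')
  have h3 := H.val_apply (ball_subset_closedBall hw')
  refine ⟨one_lt_norm_inv_conj h0 (mem_ball_zero_iff.1 h1), ?_⟩
  rw [val_swap] at h3
  rw [(f.val_inv_conj h0 h2).2, ← map_inv₀, h3, Complex.conj_conj]

lemma conj_val_of_norm {z : ℂ} (hz : ‖z‖ = 1) : conj (f.val z) = f.swap.val z := by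
  rw [val_swap, Complex.inv_eq_conj (f.norm_val_circle hz)]

lemma Face.tendsto_reflect (H : Face f.swap) {z : ℂ} (hz : ‖z‖ = 1) (h : H (f.swap.val z) = z) :
    Tendsto (fun w => (conj (H (conj w)))⁻¹) (𝓝[ball 0 1] (f.val z)) (𝓝 z) ∧
      ∀ᶠ w in 𝓝[ball 0 1] (f.val z), H (conj w) ≠ 0 := by
  have hv := conj_val_of_norm (f := f) hz
  have hmem : f.swap.val z ∈ closedBall (0 : ℂ) 1 := by
    rw [mem_closedBall_zero_iff, f.swap.norm_val_circle hz]
  have h1 : Tendsto (fun w => conj w) (𝓝[ball 0 1] (f.val z)) (𝓝[closedBall 0 1] f.swap.val z) := by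
    refine tendsto_nhdsWithin_iff.2 ⟨?_, ?_⟩
    · rw [← hv]
      exact (Complex.continuous_conj.tendsto _).mono_left nhdsWithin_le_nhds
    · filter_upwards [self_mem_nhdsWithin] with w hw
      exact ball_subset_closedBall (by simpa using hw)
  have h2 : Tendsto (fun w => H (conj w)) (𝓝[ball 0 1] (f.val z)) (𝓝 z) := by
    have := (H.cont _ hmem).tendsto.comp h1
    rwa [h] at this
  have hz0 : z ≠ 0 := by rintro rfl; simp at hz
  exact ⟨(tendsto_inv_conj hz).comp h2, h2.eventually_ne hz0⟩

lemma Face.tendsto_ball (G : Face f) {z : ℂ} (hz : ‖z‖ = 1) (h : G (f.val z) = z) :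
    Tendsto G (𝓝[ball 0 1] (f.val z)) (𝓝 z) := by
  have hmem : f.val z ∈ closedBall (0 : ℂ) 1 := by
    rw [mem_closedBall_zero_iff, f.norm_val_circle hz]
  have := (G.cont _ hmem).tendsto
  rw [h] at this
  exact this.mono_left (nhdsWithin_mono _ ball_subset_closedBall)

lemma neBot_val (f : CircleRatFun) {z : ℂ} (hz : ‖z‖ = 1) : NeBot (𝓝[ball (0 : ℂ) 1] (f.val z)) := by
  rw [← mem_closure_iff_nhdsWithin_neBot, closure_ball _ one_ne_zero, mem_closedBall_zero_iff,
    f.norm_val_circle hz]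

/-- A point of the circle that is not critical is not on the boundary of faces of both kinds. -/
lemma Face.not_both (G : Face f) (H : Face f.swap) {z : ℂ} (hz : ‖z‖ = 1)
    (hG : G (f.val z) = z) (hH : H (f.swap.val z) = z) : f.W.eval z = 0 := by
  by_contra hW
  obtain ⟨N, hN, hinj⟩ := f.exists_injOn_nhds (f.denom_ne_zero_of_norm hz) hW
  have := f.neBot_val hz
  obtain ⟨h1, h2⟩ := H.tendsto_reflect hz hH
  obtain ⟨w, hwG, hwH, hw0, hw⟩ := (((G.tendsto_ball hz hG).eventually hN).and
    ((h1.eventually hN).and (h2.and self_mem_nhdsWithin))).exists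
  obtain ⟨h3, h4⟩ := H.reflect hw hw0
  -- The reflection of H is an inverse branch of f outside the disc, so w has two preimages near z
  -- on different sides of the circle.
  have h5 : G w = (conj (H (conj w)))⁻¹ := hinj hwG hwH (by
    rw [h4, G.val_apply (ball_subset_closedBall hw)])
  have h6 := mem_ball_zero_iff.1 (G.maps hw)
  rw [h5] at h6
  linarith

/-- Near a simple critical point the function is at most two-to-one. -/
lemma exists_nhds_two_to_one (f : CircleRatFun) {y : ℂ} (hd : f.denom.eval y ≠ 0) (hW : f.W.eval y = 0)
    (hW' : (derivative f.W).eval y ≠ 0) :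
    ∃ N ∈ 𝓝 y, ∀ a ∈ N, ∀ b ∈ N, ∀ c ∈ N, f.val a = f.val b → f.val a = f.val c →
      a ≠ b → a ≠ c → b = c := by
  set ζ := f.val y with hζ
  have hζ' : f.num.eval y = ζ * f.denom.eval y := (f.val_eq_iff hd).1 rfl
  obtain ⟨Q, hQ⟩ : X - C y ∣ f.num - C ζ * f.denom := dvd_iff_isRoot.2 (by simp [hζ'])
  have hQ1 : (derivative f.num).eval y - ζ * (derivative f.denom).eval y = Q.eval y := by
    have := congrArg (fun p => (derivative p).eval y) hQ
    simpa using this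
  have hQ2 : (derivative (derivative f.num)).eval y - ζ * (derivative (derivative f.denom)).eval y =
      2 * (derivative Q).eval y := by
    have := congrArg (fun p => (derivative (derivative p)).eval y) hQ
    simp at this
    linear_combination this
  rw [W_eval, hζ'] at hW
  have hQ0 : Q.eval y = 0 := by
    rw [← hQ1]
    apply mul_left_cancel₀ hd
    linear_combination hW
  obtain ⟨R, hR⟩ : X - C y ∣ Q := dvd_iff_isRoot.2 hQ0
  have hR1 : (derivative Q).eval y = R.eval y := by
    simp [hR]
  have hR0 : R.eval y ≠ 0 := by
    intro h0
    apply hW'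
    rw [h0] at hR1
    rw [hR1, mul_zero] at hQ2
    simp only [W, wronskian, derivative_sub, derivative_mul, eval_sub, eval_add, eval_mul, hζ']
    linear_combination f.denom.eval y * hQ2
  let h : ℂ → ℂ := fun z => R.eval z / f.denom.eval z
  have hh : ∀ z, f.denom.eval z ≠ 0 → f.val z - ζ = (z - y) ^ 2 * h z := by
    intro z hz
    have := congrArg (Polynomial.eval z) hQ
    rw [hR] at this
    simp at this
    simp only [h, val]
    field_simp
    linear_combination this
  have hhy : h y ≠ 0 := div_ne_zero hR0 hd
  -- Here f − ζ = (z − y)² h with h(y) ≠ 0, and u is a local coordinate with u² h(y) = f − ζ. Near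
  -- y, distinct points with equal values have opposite u.
  let u : ℂ → ℂ := fun z => (z - y) * Complex.exp (Complex.log (h z / h y) / 2)
  have hhd : HasStrictDerivAt h _ y := (R.hasStrictDerivAt y).div (f.denom.hasStrictDerivAt y) hd
  have hslit : h y / h y ∈ Complex.slitPlane := by rw [div_self hhy]; exact Complex.one_mem_slitPlane
  have hu : HasStrictDerivAt u 1 y := by
    have h0 : HasStrictDerivAt (fun z => z - y) 1 y := (hasStrictDerivAt_id y).sub_const y
    have h1 := h0.mul (((hhd.div_const (h y)).clog hslit).div_const 2).cexp
    convert! h1 using 1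
    simp [div_self hhy]
  obtain ⟨N, hN, hinj⟩ : ∃ N ∈ 𝓝 y, InjOn u N := by
    have h1 := hu.hasStrictFDerivAt_equiv one_ne_zero
    exact ⟨_, h1.toOpenPartialHomeomorph.open_source.mem_nhds
      h1.mem_toOpenPartialHomeomorph_source, by simpa using h1.toOpenPartialHomeomorph.injOn⟩
  have h1 : ∀ᶠ z in 𝓝 y, f.denom.eval z ≠ 0 :=
    f.denom.continuous.continuousAt.eventually_ne hd
  have h2 : ∀ᶠ z in 𝓝 y, h z ≠ 0 := hhd.hasDerivAt.continuousAt.eventually_ne hhy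
  have key : ∀ z, f.denom.eval z ≠ 0 → h z ≠ 0 → u z ^ 2 * h y = f.val z - ζ := by
    intro z hz hz'
    rw [hh z hz]
    simp only [u]
    rw [mul_pow, ← Complex.exp_nat_mul]
    push_cast
    rw [mul_div_cancel₀ _ (two_ne_zero' ℂ), Complex.exp_log (div_ne_zero hz' hhy)]
    field_simp
  refine ⟨N ∩ {z | f.denom.eval z ≠ 0 ∧ h z ≠ 0}, inter_mem hN (h1.and h2), ?_⟩
  intro a ha b hb c hc hab hac nab nac
  have e (x : ℂ) (hx : x ∈ N ∩ {z | f.denom.eval z ≠ 0 ∧ h z ≠ 0}) (hax : f.val a = f.val x)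
      (nax : a ≠ x) : u x = -u a := by
    have h3 : u x ^ 2 = u a ^ 2 := by
      apply mul_right_cancel₀ hhy
      rw [key x hx.2.1 hx.2.2, key a ha.2.1 ha.2.2, hax]
    rcases sq_eq_sq_iff_eq_or_eq_neg.1 h3 with h4 | h4
    · exact (nax (hinj ha.1 hx.1 h4.symm)).elim
    · exact h4
  exact hinj hb.1 hc.1 (by rw [e b hb hab nab, e c hc hac nac])

/-- A simple vertex that is on the boundary of faces of both kinds is on the boundary of at most
one face of each kind. -/
lemma Face.eq_of_simple {G G' : Face f} (H : Face f.swap) {y : ℂ} (hy : ‖y‖ = 1)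
    (hW : f.W.eval y = 0) (hW' : (derivative f.W).eval y ≠ 0) (hG : G (f.val y) = y)
    (hG' : G' (f.val y) = y) (hH : H (f.swap.val y) = y) : G = G' := by
  obtain ⟨N, hN, htwo⟩ := f.exists_nhds_two_to_one (f.denom_ne_zero_of_norm hy) hW hW'
  have := f.neBot_val hy
  obtain ⟨h1, h2⟩ := H.tendsto_reflect hy hH
  obtain ⟨w, hwG, hwG', hwH, hw0, hw⟩ := (((G.tendsto_ball hy hG).eventually hN).and
    (((G'.tendsto_ball hy hG').eventually hN).and ((h1.eventually hN).and (h2.and self_mem_nhdsWithin)))).exists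
  obtain ⟨h3, h4⟩ := H.reflect hw hw0
  have hne (G : Face f) : (conj (H (conj w)))⁻¹ ≠ G w := fun h5 => by
    have h6 := mem_ball_zero_iff.1 (G.maps hw)
    rw [← h5] at h6
    linarith
  have hwc := ball_subset_closedBall hw
  -- The reflected face already provides one of at most two preimages of w near y, which leaves one
  -- for the inside.
  have h5 : G w = G' w := htwo _ hwH _ hwG _ hwG' (by rw [h4, G.val_apply hwc])
    (by rw [h4, G'.val_apply hwc]) (hne G) (hne G')
  exact Face.eq_of_apply_eq hwc h5 (f.W_ne_zero_of_mem_ball (G.maps hw))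

/-- An edge of the net that meets the disc is inside the disc. -/
lemma connectedComponentIn_subset_ball (f : CircleRatFun) {z : ℂ} (hz : ‖z‖ < 1)
    (hn : z ∈ f.net \ f.vertices) :
    connectedComponentIn (f.net \ f.vertices) z ⊆ ball 0 1 := by
  set e := connectedComponentIn (f.net \ f.vertices) z
  have hpre : IsPreconnected e := isPreconnected_connectedComponentIn
  have hsub : e ⊆ f.net \ f.vertices := connectedComponentIn_subset _ _
  have hze : z ∈ e := mem_connectedComponentIn hn
  -- Away from the vertices the net inside the disc does not accumulate at the circle, so the disc
  -- and this open set cover e, and they do not meet on the net.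
  set v : Set ℂ := (closure (ball 0 1 ∩ f.net))ᶜ
  have hcov : e ⊆ ball 0 1 ∪ v := by
    intro x hx
    by_cases hxb : x ∈ ball (0 : ℂ) 1
    · exact Or.inl hxb
    · right
      intro hxc
      have h1 : x ∈ closedBall (0 : ℂ) 1 := by
        rw [← closure_ball _ one_ne_zero]
        exact closure_mono inter_subset_left hxc
      have h2 : ‖x‖ = 1 := le_antisymm (by simpa using h1) (by simpa using hxb)
      have h3 := f.eventually_norm_val_ne_one h2 ((hsub hx).2)
      obtain ⟨w, hw, hw'⟩ := ((mem_closure_iff_frequently.1 hxc).and_eventually h3).exists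
      exact hw' (mem_ball_zero_iff.1 hw.1) hw.2
  intro x hx
  by_contra hxb
  obtain ⟨w, hw, hwb, hwv⟩ := hpre (ball 0 1) v isOpen_ball isClosed_closure.isOpen_compl hcov
    ⟨z, hze, mem_ball_zero_iff.2 hz⟩ ⟨x, hx, (hcov hx).resolve_left hxb⟩
  exact hwv (subset_closure ⟨hwb, (hsub hw).1⟩)

/-! ### Gaps of faces and chords -/

namespace Face

/-- The angle at which the boundary of a face passes through a point of the unit circle. -/
noncomputable def arg (G : Face f) : ℝ → ℝ := G.exists_argument.choose

variable (G : Face f)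

lemma circlePt_arg {t : ℝ} (ht : t ∈ G.angles) : circlePt (G.arg t) = f.val (circlePt t) :=
  G.exists_argument.choose_spec.1 t ht

lemma arg_lt {t t' : ℝ} (ht : t ∈ G.angles) (ht' : t' ∈ G.angles) (h : t < t')
    (h' : t' < t + 2 * Real.pi) : G.arg t < G.arg t' :=
  (G.exists_argument.choose_spec.2.1 t ht t' ht' h h').1

lemma arg_lt_add {t t' : ℝ} (ht : t ∈ G.angles) (ht' : t' ∈ G.angles) (h : t < t')
    (h' : t' < t + 2 * Real.pi) : G.arg t' < G.arg t + 2 * Real.pi :=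
  (G.exists_argument.choose_spec.2.1 t ht t' ht' h h').2

lemma arg_add_two_pi (t : ℝ) : G.arg (t + 2 * Real.pi) = G.arg t + 2 * Real.pi :=
  G.exists_argument.choose_spec.2.2 t

lemma apply_circlePt_arg {t : ℝ} (ht : t ∈ G.angles) :
    G (circlePt (G.arg t)) = circlePt t := by
  rw [G.circlePt_arg ht, mem_angles_iff.1 ht]

lemma continuous_apply_circlePt : Continuous fun s => G (circlePt s) :=
  G.cont.comp_continuous continuous_circlePt fun s => by simp [norm_circlePt]

lemma circlePt_mem_closedBall (s : ℝ) : circlePt s ∈ closedBall (0 : ℂ) 1 := by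
  simp [norm_circlePt]

lemma norm_val_apply_circlePt (s : ℝ) : ‖f.val (G (circlePt s))‖ = 1 := by
  rw [G.val_apply (circlePt_mem_closedBall s), norm_circlePt]

lemma norm_apply_le (s : ℝ) : ‖G (circlePt s)‖ ≤ 1 :=
  mem_closedBall_zero_iff.1 (G.mapsTo_closedBall (circlePt_mem_closedBall s))

/-- A boundary point on the circle would have an angle t in [t₁, t₁ + 2π). By the cyclic order its
parameter could lie between those of t₁ and t₂ only if t were inside the gap. -/
lemma norm_apply_lt_one {t₁ t₂ : ℝ} (h₁ : t₁ ∈ G.angles) (h₂ : t₂ ∈ G.angles) (h12 : t₁ < t₂)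
    (h21 : t₂ < t₁ + 2 * Real.pi) (hgap : ∀ t ∈ Ioo t₁ t₂, t ∉ G.angles) {s : ℝ}
    (hs : s ∈ Ioo (G.arg t₁) (G.arg t₂)) : ‖G (circlePt s)‖ < 1 := by
  refine lt_of_le_of_ne (G.norm_apply_le s) fun h => ?_
  obtain ⟨t, ht, hte⟩ := exists_circlePt_eq_Ico h t₁
  have htG : t ∈ G.angles := ⟨_, norm_circlePt s, hte.symm⟩
  have he : circlePt (G.arg t) = circlePt s := by
    rw [G.circlePt_arg htG, hte, G.val_apply (circlePt_mem_closedBall s)]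
  have h4 := G.arg_lt_add h₁ h₂ h12 h21
  rcases ht.1.eq_or_lt with rfl | h1
  · exact circlePt_ne hs.1 (hs.2.trans h4) he.symm
  · rcases lt_trichotomy t t₂ with h2 | rfl | h2
    · exact hgap t ⟨h1, h2⟩ htG
    · exact circlePt_ne hs.2 (by linarith [hs.1]) he
    · have h5 := G.arg_lt h₂ htG h2 (by linarith [ht.2])
      have h6 := G.arg_lt_add h₁ htG h1 ht.2
      exact circlePt_ne (hs.2.trans h5) (by linarith [hs.1]) he

lemma mem_net_diff_vertices {s : ℝ} (hs : ‖G (circlePt s)‖ < 1) :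
    G (circlePt s) ∈ f.net \ f.vertices :=
  ⟨G.norm_val_apply_circlePt s, f.W_ne_zero_of_mem_ball (mem_ball_zero_iff.2 hs)⟩

lemma frequently_mem_gap {a b s : ℝ} (hab : a < b) (hs : s ∈ Icc a b) {p : ℝ → Prop}
    (hp : ∀ u ∈ Ioo a b, p u) : ∃ᶠ u in 𝓝 s, p u := by
  have : s ∈ closure (Ioo a b) := by rwa [closure_Ioo hab.ne]
  exact (mem_closure_iff_frequently.1 this).mono hp

/-- A limit of points of the net inside the disc is critical. -/
lemma mem_vertices_of_gap {a b s t : ℝ} (hab : a < b) (hs : s ∈ Icc a b)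
    (hgap : ∀ u ∈ Ioo a b, ‖G (circlePt u)‖ < 1) (ht : G (circlePt s) = circlePt t) :
    circlePt t ∈ f.vertices := by
  by_contra hW
  have h1 := f.eventually_norm_val_ne_one (norm_circlePt t) hW
  rw [← ht] at h1
  obtain ⟨u, hu, hu'⟩ := ((frequently_mem_gap hab hs hgap).and_eventually
    (G.continuous_apply_circlePt.continuousAt.eventually h1)).exists
  exact hu' hu (G.norm_val_apply_circlePt u)

/-- The face on the other side of a chord. -/
lemma exists_opposite {a b : ℝ} (hab : a < b)
    (hgap : ∀ u ∈ Ioo a b, ‖G (circlePt u)‖ < 1) :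
    ∃ H : Face f.swap, ∀ u ∈ Icc a b, H (circlePt (-u)) = G (circlePt u) := by
  obtain ⟨m, hm⟩ := nonempty_Ioo.2 hab
  obtain ⟨H, hH⟩ := f.swap.exists_face_of_norm_val_eq (hgap m hm) (by
    rw [val_swap, norm_inv, G.norm_val_apply_circlePt, inv_one])
  -- On the chord 1/f takes the value e^{−iu}, so the face on the other side traverses it backwards.
  have hval (u : ℝ) : f.swap.val (G (circlePt u)) = circlePt (-u) := by
    rw [val_swap, G.val_apply (circlePt_mem_closedBall u), circlePt_neg]
  rw [hval] at hH
  have hcH : Continuous fun u : ℝ => H (circlePt (-u)) :=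
    H.continuous_apply_circlePt.comp continuous_neg
  refine ⟨H, ?_⟩
  have h1 : EqOn (fun u : ℝ => H (circlePt (-u))) (fun u => G (circlePt u)) (Ioo a b) := by
    refine isPreconnected_Ioo.eqOn_of_eventually_eq hcH.continuousOn
      G.continuous_apply_circlePt.continuousOn (fun u hu hue => ?_) hm hH
    have hz := f.swap.W_ne_zero_of_mem_ball (mem_ball_zero_iff.2 (hgap u hu))
    have hd : f.swap.denom.eval (G (circlePt u)) ≠ 0 := by
      apply f.swap.denom_ne_zero_of_norm_val
      rw [hval, norm_circlePt]
    obtain ⟨N, hN, hinj⟩ := f.swap.exists_injOn_nhds hd hz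
    refine nhdsWithin_le_nhds ?_
    have hN' : N ∈ 𝓝 (H (circlePt (-u))) := by
      have hue' : H (circlePt (-u)) = G (circlePt u) := hue
      rwa [hue']
    filter_upwards [hcH.continuousAt.eventually hN',
      G.continuous_apply_circlePt.continuousAt.eventually hN] with y h1 h2
    exact hinj h1 h2 (by rw [hval, H.val_apply (circlePt_mem_closedBall _)])
  intro u hu
  exact h1.closure hcH G.continuous_apply_circlePt (by rwa [closure_Ioo hab.ne])

/-- A gap between the points of the unit circle on the boundary of a face is filled by a chord,
and the face on the other side of the chord has no points of the unit circle outside the gap. -/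
lemma chordJoins_of_gap {t₁ t₂ : ℝ} (h₁ : t₁ ∈ G.angles) (h₂ : t₂ ∈ G.angles) (h12 : t₁ < t₂)
    (h21 : t₂ < t₁ + 2 * Real.pi) (hgap : ∀ t ∈ Ioo t₁ t₂, t ∉ G.angles) :
    f.ChordJoins (circlePt t₁) (circlePt t₂) ∧ circlePt t₂ ∈ f.vertices ∧
      ∃ H : Face f.swap, t₁ ∈ H.angles ∧ t₂ ∈ H.angles ∧
        ∀ t ∈ Ioo t₂ (t₁ + 2 * Real.pi), t ∉ H.angles := by
  have hs := G.arg_lt h₁ h₂ h12 h21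
  have hlt : ∀ u ∈ Ioo (G.arg t₁) (G.arg t₂), ‖G (circlePt u)‖ < 1 := fun u hu =>
    G.norm_apply_lt_one h₁ h₂ h12 h21 hgap hu
  have e₁ := G.apply_circlePt_arg h₁
  have e₂ := G.apply_circlePt_arg h₂
  refine ⟨?_, G.mem_vertices_of_gap hs (right_mem_Icc.2 hs.le) hlt e₂, ?_⟩
  · obtain ⟨m, hm⟩ := nonempty_Ioo.2 hs
    have hsub : (fun u => G (circlePt u)) '' Ioo (G.arg t₁) (G.arg t₂) ⊆
        connectedComponentIn (f.net \ f.vertices) (G (circlePt m)) := by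
      refine (isPreconnected_Ioo.image _
        G.continuous_apply_circlePt.continuousOn).subset_connectedComponentIn ⟨m, hm, rfl⟩ ?_
      rintro _ ⟨u, hu, rfl⟩
      exact G.mem_net_diff_vertices (hlt u hu)
    have hcl : ∀ u ∈ Icc (G.arg t₁) (G.arg t₂), G (circlePt u) ∈
        closure (connectedComponentIn (f.net \ f.vertices) (G (circlePt m))) := by
      intro u hu
      refine closure_mono hsub (image_closure_subset_closure_image G.continuous_apply_circlePt
        ⟨u, ?_, rfl⟩)
      rwa [closure_Ioo hs.ne]
    refine ⟨_, ⟨⟨_, G.mem_net_diff_vertices (hlt m hm), rfl⟩,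
      f.connectedComponentIn_subset_ball (hlt m hm) (G.mem_net_diff_vertices (hlt m hm))⟩, ?_, ?_⟩
    · rw [← e₁]; exact hcl _ (left_mem_Icc.2 hs.le)
    · rw [← e₂]; exact hcl _ (right_mem_Icc.2 hs.le)
  · obtain ⟨H, hH⟩ := G.exists_opposite hs hlt
    have k₁ := hH _ (left_mem_Icc.2 hs.le)
    have k₂ := hH _ (right_mem_Icc.2 hs.le)
    rw [e₁] at k₁
    rw [e₂] at k₂
    have m₁ : t₁ ∈ H.angles := ⟨_, norm_circlePt _, k₁⟩
    have m₂ : t₂ ∈ H.angles := ⟨_, norm_circlePt _, k₂⟩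
    refine ⟨H, m₁, m₂, fun t ht htH => ?_⟩
    have m₁' : t₁ + 2 * Real.pi ∈ H.angles := add_two_pi_mem_angles.2 m₁
    have c₁ : circlePt (H.arg t₁) = circlePt (-G.arg t₁) := by
      rw [H.circlePt_arg m₁, ← k₁, H.val_apply (circlePt_mem_closedBall _)]
    have c₂ : circlePt (H.arg t₂) = circlePt (-G.arg t₂) := by
      rw [H.circlePt_arg m₂, ← k₂, H.val_apply (circlePt_mem_closedBall _)]
    obtain ⟨p, hp⟩ := circlePt_eq_iff.1 c₁
    obtain ⟨q, hq⟩ := circlePt_eq_iff.1 c₂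
    have l1 := H.arg_lt m₂ m₁' h21 (by linarith)
    have l2 := H.arg_lt_add m₂ m₁' h21 (by linarith)
    have l3 := G.arg_lt_add h₁ h₂ h12 h21
    have l4 := H.arg_lt m₂ htH ht.1 (by linarith [ht.2])
    have l5 := H.arg_lt htH m₁' ht.2 (by linarith [ht.1])
    rw [H.arg_add_two_pi] at l1 l2 l5
    have hpi := Real.pi_pos
    -- The H-increment from t₂ to t₁ + 2π equals the G-increment from t₁ to t₂ plus 2π(p + 1 − q).
    -- Both lie in (0, 2π), so the integer is 0.
    have hpq : (p : ℝ) + 1 = q := by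
      have u1 : p + 1 - q < 1 := by
        have : (p + 1 - q : ℝ) < 1 := by
          by_contra! hc
          nlinarith
        exact_mod_cast this
      have u2 : -1 < p + 1 - q := by
        have : (-1 : ℝ) < p + 1 - q := by
          by_contra! hc
          nlinarith
        exact_mod_cast this
      have : p + 1 = q := by omega
      exact_mod_cast this
    -- A further angle t of H would have a parameter on the chord, whose points are strictly inside
    -- the disc.
    set s := -(H.arg t - q * (2 * Real.pi)) with hsdef
    have hsm : s ∈ Ioo (G.arg t₁) (G.arg t₂) := by
      rw [← hpq] at hq hsdef
      constructor <;> linarith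
    have h1 := hH s (Ioo_subset_Icc_self hsm)
    have h2 : circlePt (-s) = circlePt (H.arg t) := circlePt_eq_iff.2 ⟨-q, by
      rw [hsdef]; push_cast; ring⟩
    rw [h2, H.apply_circlePt_arg htH] at h1
    have h3 := hlt s hsm
    rw [← h1, norm_circlePt] at h3
    exact lt_irrefl _ h3

/-- An angle of the boundary point gives s only modulo 2π; shifting the angle by a full turn shifts
`arg` by the same amount. -/
lemma exists_arg_eq {s : ℝ} (hs : ‖G (circlePt s)‖ = 1) : ∃ t ∈ G.angles, G.arg t = s := by
  obtain ⟨t, ht⟩ := exists_circlePt_eq hs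
  have htG : t ∈ G.angles := ⟨_, norm_circlePt s, ht.symm⟩
  have he : circlePt s = circlePt (G.arg t) := by
    rw [G.circlePt_arg htG, ht, G.val_apply (circlePt_mem_closedBall s)]
  obtain ⟨k, hk⟩ := circlePt_eq_iff.1 he
  have hind : ∀ k : ℤ, t + k * (2 * Real.pi) ∈ G.angles ∧
      G.arg (t + k * (2 * Real.pi)) = G.arg t + k * (2 * Real.pi) := by
    intro k
    induction k with
    | zero => simpa using htG
    | succ n ih =>
      have e : t + ((n : ℤ) + 1 : ℤ) * (2 * Real.pi) = t + (n : ℤ) * (2 * Real.pi) + 2 * Real.pi := by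
        push_cast; ring
      rw [e, add_two_pi_mem_angles, arg_add_two_pi, ih.2]
      exact ⟨ih.1, by push_cast; ring⟩
    | pred n ih =>
      have e : t + (-(n : ℤ) : ℤ) * (2 * Real.pi) =
          t + (-(n : ℤ) - 1 : ℤ) * (2 * Real.pi) + 2 * Real.pi := by
        push_cast; ring
      rw [e, add_two_pi_mem_angles, arg_add_two_pi] at ih
      refine ⟨ih.1, ?_⟩
      have := ih.2
      push_cast at this ⊢
      linarith
  exact ⟨_, (hind k).1, by rw [(hind k).2, hk]⟩

end Face

/-- Each chord that joins two points of the unit circle fills a gap of a face. -/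
lemma exists_gap_of_chordJoins {y y' : ℂ} (hy : ‖y‖ = 1) (hy' : ‖y'‖ = 1) (hne : y ≠ y')
    (h : f.ChordJoins y y') : ∃ G : Face f, ∃ t₁ ∈ G.angles, ∃ t₂ ∈ G.angles, t₁ < t₂ ∧
      t₂ < t₁ + 2 * Real.pi ∧ (∀ t ∈ Ioo t₁ t₂, t ∉ G.angles) ∧
      (circlePt t₁ = y ∧ circlePt t₂ = y' ∨ circlePt t₁ = y' ∧ circlePt t₂ = y) := by
  obtain ⟨e, ⟨⟨z₀, hz₀, he⟩, hball⟩, hye, hye'⟩ := h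
  have hpre : IsPreconnected e := he ▸ isPreconnected_connectedComponentIn
  have hsub : e ⊆ f.net \ f.vertices := he ▸ connectedComponentIn_subset _ _
  have hz₀e : z₀ ∈ e := he ▸ mem_connectedComponentIn hz₀
  have hnorm : ∀ z ∈ e, ‖f.val z‖ = 1 := fun z hz => (hsub hz).1
  have hlt : ∀ z ∈ e, ‖z‖ < 1 := fun z hz => mem_ball_zero_iff.1 (hball hz)
  have hd : ∀ z ∈ e, f.denom.eval z ≠ 0 := fun z hz => f.denom_ne_zero_of_norm_val (hnorm z hz)
  have hvc : ContinuousOn f.val e := fun z hz => (f.continuousAt_val (hd z hz)).continuousWithinAt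
  obtain ⟨G, hG⟩ := f.exists_face_of_norm_val_eq (hlt _ hz₀e) (hnorm _ hz₀e)
  have hGc : ContinuousOn (fun z => G (f.val z)) e := G.cont.comp hvc fun z hz => by
    simp [hnorm z hz]
  -- The branch through one point of the chord inverts f along the whole connected chord.
  have hGe : EqOn (fun z => G (f.val z)) id e := by
    refine hpre.eqOn_of_eventually_eq hGc continuousOn_id (fun z hz hze => ?_) hz₀e hG
    obtain ⟨N, hN, hinj⟩ := f.exists_injOn_nhds (hd z hz)
      (f.W_ne_zero_of_mem_ball (mem_ball_zero_iff.2 (hlt z hz)))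
    have hN' : N ∈ 𝓝 (G (f.val z)) := by
      have hze' : G (f.val z) = z := hze
      rwa [hze']
    filter_upwards [(hGc z hz).eventually hN', nhdsWithin_le_nhds hN, self_mem_nhdsWithin]
      with x h1 h2 h3
    exact hinj h1 h2 (by rw [G.val_apply (by simp [hnorm x h3])]; rfl)
  set T : Set ℝ := {s | ‖G (circlePt s)‖ = 1} with hT
  have hTc : IsClosed T := isClosed_eq G.continuous_apply_circlePt.norm continuous_const
  have hTadd : ∀ s, s + 2 * Real.pi ∈ T ↔ s ∈ T := fun s => by
    simp only [hT, mem_ofPred_eq, circlePt_add_two_pi]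
  have hcover : ∀ z ∈ closure e, ∃ ζ, ‖ζ‖ = 1 ∧ G ζ = z := by
    intro z hz
    have h1 : IsClosed (G '' sphere 0 1) := ((isCompact_sphere (0 : ℂ) 1).image_of_continuousOn
      (G.cont.mono sphere_subset_closedBall)).isClosed
    have h2 : e ⊆ G '' sphere 0 1 := fun z hz => ⟨f.val z, by simp [hnorm z hz], hGe hz⟩
    obtain ⟨ζ, hζ, h⟩ := closure_minimal h2 h1 hz
    exact ⟨ζ, by simpa using hζ, h⟩
  obtain ⟨ζ, hζ, hζy⟩ := hcover y hye
  obtain ⟨s₀, hs₀⟩ := exists_circlePt_eq (hnorm _ hz₀e)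
  have hs₀T : s₀ ∉ T := by
    intro h
    have h1 : ‖G (circlePt s₀)‖ = 1 := h
    rw [hs₀, hG] at h1
    exact (hlt _ hz₀e).ne h1
  obtain ⟨u, hu, hue⟩ := exists_circlePt_eq_Ico hζ s₀
  have huT : u ∈ T := by
    simp only [hT, mem_ofPred_eq]
    rw [hue, hζy, hy]
  have huT' : u - 2 * Real.pi ∈ T := by
    rw [← hTadd]; simpa using huT
  -- the maximal interval around `s₀` that is free of points of `T`
  obtain ⟨s₁, hs₁, hs₁max⟩ := (isCompact_Icc.inter_right hTc).exists_isGreatest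
    (⟨u - 2 * Real.pi, ⟨le_rfl, by linarith [hu.2]⟩, huT'⟩ :
      (Icc (u - 2 * Real.pi) s₀ ∩ T).Nonempty)
  obtain ⟨s₂, hs₂, hs₂min⟩ := (isCompact_Icc.inter_right hTc).exists_isLeast
    (⟨u, ⟨hu.1, le_rfl⟩, huT⟩ : (Icc s₀ u ∩ T).Nonempty)
  have hs₁0 : s₁ < s₀ := lt_of_le_of_ne hs₁.1.2 fun h => hs₀T (h ▸ hs₁.2)
  have hs₂0 : s₀ < s₂ := lt_of_le_of_ne hs₂.1.1 fun h => hs₀T (h ▸ hs₂.2)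
  have hfree : ∀ s ∈ Ioo s₁ s₂, s ∉ T := by
    intro s hs hsT
    rcases le_total s s₀ with h | h
    · exact absurd (hs₁max ⟨⟨by linarith [hs₁.1.1, hs.1], h⟩, hsT⟩) (not_le.2 hs.1)
    · exact absurd (hs₂min ⟨⟨h, by linarith [hs₂.1.2, hs.2]⟩, hsT⟩) (not_le.2 hs.2)
  have hle : s₂ ≤ s₁ + 2 * Real.pi := by linarith [hs₁.1.1, hs₂.1.2]
  -- the chord is the image of this interval
  have harc : ∀ z ∈ e, f.val z ∈ circlePt '' Icc s₁ s₂ := by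
    have hC (a b : ℝ) : IsClosed (circlePt '' Icc a b) :=
      (isCompact_Icc.image continuous_circlePt).isClosed
    have hpre' : IsPreconnected (f.val '' e) := hpre.image _ hvc
    have hcov : ∀ z ∈ e, f.val z ∈ circlePt '' Ioo s₁ s₂ ∨
        f.val z ∈ circlePt '' Ioo s₂ (s₁ + 2 * Real.pi) := by
      intro z hz
      obtain ⟨s, hs, hse⟩ := exists_circlePt_eq_Ico (hnorm z hz) s₁
      have hsT : s ∉ T := by
        intro h
        have h1 : ‖G (circlePt s)‖ = 1 := h
        rw [hse] at h1
        have h2 : G (f.val z) = z := hGe hz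
        rw [h2] at h1
        exact (hlt _ hz).ne h1
      rcases hs.1.eq_or_lt with rfl | h1
      · exact absurd hs₁.2 hsT
      · rcases lt_trichotomy s s₂ with h2 | rfl | h2
        · exact Or.inl ⟨s, ⟨h1, h2⟩, hse⟩
        · exact absurd hs₂.2 hsT
        · exact Or.inr ⟨s, ⟨h2, hs.2⟩, hse⟩
    have hdisj1 : ∀ z ∈ circlePt '' Ioo s₁ s₂, z ∉ circlePt '' Icc s₂ (s₁ + 2 * Real.pi) := by
      rintro _ ⟨s, hs, rfl⟩ ⟨s', hs', h⟩
      exact circlePt_ne (hs.2.trans_le hs'.1) (by linarith [hs.1, hs'.2]) h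
    have hdisj2 : ∀ z ∈ circlePt '' Ioo s₂ (s₁ + 2 * Real.pi), z ∉ circlePt '' Icc s₁ s₂ := by
      rintro _ ⟨s, hs, rfl⟩ ⟨s', hs', h⟩
      exact circlePt_ne (hs'.2.trans_lt hs.1) (by linarith [hs.2, hs'.1]) h.symm
    intro z hz
    by_contra hzn
    obtain ⟨_, ⟨x, hx, rfl⟩, hx1, hx2⟩ := hpre' (circlePt '' Icc s₂ (s₁ + 2 * Real.pi))ᶜ
      (circlePt '' Icc s₁ s₂)ᶜ (hC _ _).isOpen_compl (hC _ _).isOpen_compl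
      (by
        rintro _ ⟨x, hx, rfl⟩
        rcases hcov x hx with h | h
        · exact Or.inl (hdisj1 _ h)
        · exact Or.inr (hdisj2 _ h))
      ⟨_, ⟨z₀, hz₀e, rfl⟩, hdisj1 _ ⟨s₀, ⟨hs₁0, hs₂0⟩, hs₀⟩⟩
      ⟨_, ⟨z, hz, rfl⟩, hzn⟩
    rcases hcov x hx with ⟨s, hs, h⟩ | ⟨s, hs, h⟩
    · exact hx2 ⟨s, Ioo_subset_Icc_self hs, h⟩
    · exact hx1 ⟨s, Ioo_subset_Icc_self hs, h⟩
  have hends : ∀ z ∈ closure e, ‖z‖ = 1 → z = G (circlePt s₁) ∨ z = G (circlePt s₂) := by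
    intro z hz hz1
    have h1 : IsClosed ((fun s => G (circlePt s)) '' Icc s₁ s₂) :=
      (isCompact_Icc.image G.continuous_apply_circlePt).isClosed
    have h2 : e ⊆ (fun s => G (circlePt s)) '' Icc s₁ s₂ := by
      intro z hz
      obtain ⟨s, hs, hse⟩ := harc z hz
      refine ⟨s, hs, ?_⟩
      simp only [hse]
      exact hGe hz
    obtain ⟨s, hs, rfl⟩ := closure_minimal h2 h1 hz
    rcases hs.1.eq_or_lt with rfl | h3
    · exact Or.inl rfl
    · rcases hs.2.eq_or_lt with rfl | h4
      · exact Or.inr rfl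
      · exact absurd hz1 (hfree s ⟨h3, h4⟩)
  -- The closure of the chord meets the circle in at most these two points and contains y ≠ y'. This
  -- also excludes s₂ = s₁ + 2π.
  have hG12 : G (circlePt s₁) ≠ G (circlePt s₂) := by
    intro h
    rcases hends y hye hy with h1 | h1 <;> rcases hends y' hye' hy' with h2 | h2 <;>
      exact hne (by simp [h1, h2, h])
  have hlt' : s₂ < s₁ + 2 * Real.pi := by
    refine lt_of_le_of_ne hle fun h => hG12 ?_
    rw [h, circlePt_add_two_pi]
  obtain ⟨t₁, ht₁, hts₁⟩ := G.exists_arg_eq hs₁.2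
  have e₁ := G.apply_circlePt_arg ht₁
  rw [hts₁] at e₁
  obtain ⟨t₂, ht₂, hte₂⟩ := exists_circlePt_eq_Ico (z := G (circlePt s₂)) hs₂.2 t₁
  have ht₂G : t₂ ∈ G.angles := ⟨_, norm_circlePt s₂, hte₂.symm⟩
  have ht12 : t₁ < t₂ := lt_of_le_of_ne ht₂.1 fun h => hG12 (by rw [e₁, ← hte₂, h])
  have l1 := G.arg_lt ht₁ ht₂G ht12 ht₂.2
  have l2 := G.arg_lt_add ht₁ ht₂G ht12 ht₂.2
  have e₃ : circlePt (G.arg t₂) = circlePt s₂ := by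
    rw [G.circlePt_arg ht₂G, hte₂, G.val_apply (Face.circlePt_mem_closedBall s₂)]
  have hts₂ : G.arg t₂ = s₂ := by
    rcases lt_trichotomy (G.arg t₂) s₂ with h | h | h
    · exact absurd e₃.symm (circlePt_ne h (by linarith))
    · exact h
    · exact absurd e₃ (circlePt_ne h (by linarith))
  refine ⟨G, t₁, ht₁, t₂, ht₂G, ht12, ht₂.2, fun t ht htG => ?_, ?_⟩
  · have l3 := G.arg_lt ht₁ htG ht.1 (by linarith [ht.2, ht₂.2])
    have l4 := G.arg_lt htG ht₂G ht.2 (by linarith [ht.1, ht₂.2])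
    refine hfree (G.arg t) ⟨by linarith, by linarith⟩ ?_
    simp only [hT, mem_ofPred_eq]
    rw [G.apply_circlePt_arg htG, norm_circlePt]
  · rw [← e₁, hte₂]
    rcases hends y hye hy with h1 | h1 <;> rcases hends y' hye' hy' with h2 | h2
    · exact (hne (h1.trans h2.symm)).elim
    · exact Or.inl ⟨h1.symm, h2.symm⟩
    · exact Or.inr ⟨h2.symm, h1.symm⟩
    · exact (hne (h1.trans h2.symm)).elim

end CircleRatFun

/-! ### The argument of f along the circle -/

lemma hasDerivAt_circlePt (t : ℝ) : HasDerivAt circlePt (Complex.I * circlePt t) t := by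
  have h1 : HasDerivAt (fun s : ℝ => (s : ℂ) * Complex.I) Complex.I t := by
    simpa using (Complex.ofRealCLM.hasDerivAt (x := t)).mul_const Complex.I
  have h2 := h1.cexp
  rwa [mul_comm] at h2

namespace CircleRatFun

variable (f : CircleRatFun)

/-- The derivative of the argument along the unit circle. -/
noncomputable def argDeriv (t : ℝ) : ℂ := f.W.eval (circlePt t) *
  (circlePt t / (f.num.eval (circlePt t) * f.denom.eval (circlePt t)))

lemma hasDerivAt_val_circlePt (t : ℝ) : HasDerivAt (fun s => f.val (circlePt s))
    (Complex.I * f.argDeriv t * f.val (circlePt t)) t := by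
  have hd := f.denom_ne_zero_of_norm (norm_circlePt t)
  have hn := f.num_ne_zero_of_norm (norm_circlePt t)
  have := (f.hasStrictDerivAt_val hd).hasDerivAt.comp t (hasDerivAt_circlePt t)
  convert! this using 1
  rw [argDeriv, val]
  field_simp

lemma continuous_argDeriv : Continuous f.argDeriv := by
  refine (f.W.continuous.comp continuous_circlePt).mul (continuous_circlePt.div₀
    ((f.num.continuous.comp continuous_circlePt).mul
      (f.denom.continuous.comp continuous_circlePt)) fun t => ?_)
  exact mul_ne_zero (f.num_ne_zero_of_norm (norm_circlePt t))
    (f.denom_ne_zero_of_norm (norm_circlePt t))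

/-- Differentiate f · conj f = 1 along the circle. -/
lemma argDeriv_im (t : ℝ) : (f.argDeriv t).im = 0 := by
  have h1 := f.hasDerivAt_val_circlePt t
  have h2 : HasDerivAt (fun s => f.val (circlePt s) * conj (f.val (circlePt s)))
      (Complex.I * f.argDeriv t * f.val (circlePt t) * conj (f.val (circlePt t)) +
        f.val (circlePt t) * conj (Complex.I * f.argDeriv t * f.val (circlePt t))) t :=
    h1.mul (Complex.conjCLE.hasFDerivAt.comp_hasDerivAt t h1)
  have h3 : (fun s => f.val (circlePt s) * conj (f.val (circlePt s))) = fun _ => 1 := by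
    ext s
    rw [Complex.mul_conj', f.norm_val_circle (norm_circlePt s)]
    simp
  rw [h3] at h2
  have h4 := h2.unique (hasDerivAt_const t 1)
  have h5 := congrFun h3 t
  simp only [map_mul, Complex.conj_I] at h4 h5
  have h6 : Complex.I * (f.argDeriv t - conj (f.argDeriv t)) = 0 := by
    linear_combination h4 - Complex.I * (f.argDeriv t - conj (f.argDeriv t)) * h5
  have h7 := (mul_eq_zero.1 h6).resolve_left Complex.I_ne_zero
  exact Complex.conj_eq_iff_im.1 (sub_eq_zero.1 h7).symm

/-- A smooth choice of the argument of `f` along the unit circle. -/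
lemma exists_argument : ∃ φ : ℝ → ℝ, f.IsArgOn univ φ ∧
    ∀ t, HasDerivAt φ (f.argDeriv t).re t := by
  obtain ⟨c, hc⟩ := exists_circlePt_eq (f.norm_val_circle (norm_circlePt 0))
  have hcont : Continuous fun t => (f.argDeriv t).re := Complex.continuous_re.comp f.continuous_argDeriv
  let φ : ℝ → ℝ := fun t => c + ∫ s in (0 : ℝ)..t, (f.argDeriv s).re
  have hφ : ∀ t, HasDerivAt φ (f.argDeriv t).re t := fun t =>
    (intervalIntegral.integral_hasDerivAt_right (hcont.intervalIntegrable _ _)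
      (hcont.stronglyMeasurableAtFilter _ _) hcont.continuousAt).const_add c
  suffices h : ∀ t, f.val (circlePt t) = circlePt (φ t) from
    ⟨φ, ⟨fun t _ => (hφ t).continuousAt.continuousWithinAt, fun t _ => h t⟩, hφ⟩
  have hre (t : ℝ) : ((f.argDeriv t).re : ℂ) = f.argDeriv t :=
    Complex.ext (by simp) (by simp [f.argDeriv_im t])
  -- The product f · e^{−iφ} has derivative 0, so it keeps its value 1 at the angle 0.
  have h1 (t : ℝ) : HasDerivAt (fun s => f.val (circlePt s) * circlePt (-φ s)) 0 t := by
    have h2 : HasDerivAt (fun s => circlePt (-φ s))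
        (-(f.argDeriv t).re • (Complex.I * circlePt (-φ t))) t :=
      HasDerivAt.scomp (g₁ := circlePt) (h := fun s => -φ s) t (hasDerivAt_circlePt (-φ t)) (hφ t).neg
    have h3 := (f.hasDerivAt_val_circlePt t).mul h2
    convert! h3 using 1
    simp only [Complex.real_smul, Complex.ofReal_neg, hre]
    ring
  intro t
  have h2 := is_const_of_deriv_eq_zero (fun s => (h1 s).differentiableAt) (fun s => (h1 s).deriv) t 0
  have h3 : φ 0 = c := by simp [φ]
  rw [h3, ← hc, circlePt_neg, circlePt_neg, mul_inv_cancel₀ (circlePt_ne_zero c)] at h2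
  rw [mul_inv_eq_one₀ (circlePt_ne_zero _)] at h2
  exact h2

/-- Since W vanishes here, only the term with W' survives in the product rule; it is nonzero, and it
is real because `argDeriv` is real. Thus the derivative of the argument has a simple zero at a
simple vertex. -/
lemma hasDerivAt_argDeriv {t : ℝ} (hW : f.W.eval (circlePt t) = 0)
    (hW' : (derivative f.W).eval (circlePt t) ≠ 0) :
    ∃ a ≠ 0, HasDerivAt (fun s => (f.argDeriv s).re) a t := by
  have hd := f.denom_ne_zero_of_norm (norm_circlePt t)
  have hn := f.num_ne_zero_of_norm (norm_circlePt t)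
  have h1 : HasDerivAt f.argDeriv _ t :=
    ((f.W.hasDerivAt (circlePt t)).comp t (hasDerivAt_circlePt t)).mul
    ((hasDerivAt_circlePt t).div (((f.num.hasDerivAt (circlePt t)).comp t (hasDerivAt_circlePt t)).mul
      ((f.denom.hasDerivAt (circlePt t)).comp t (hasDerivAt_circlePt t))) (mul_ne_zero hn hd))
  simp only [Function.comp, hW, zero_mul, add_zero] at h1
  set a := (derivative f.W).eval (circlePt t) * (Complex.I * circlePt t) *
    (circlePt t / (f.num.eval (circlePt t) * f.denom.eval (circlePt t))) with ha
  have ha0 : a ≠ 0 := mul_ne_zero (mul_ne_zero hW' (mul_ne_zero Complex.I_ne_zero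
    (circlePt_ne_zero t))) (div_ne_zero (circlePt_ne_zero t) (mul_ne_zero hn hd))
  have h2 : HasDerivAt (fun s => (f.argDeriv s).re) a.re t :=
    (Complex.reCLM.hasFDerivAt.comp_hasDerivAt t h1)
  have h3 : HasDerivAt (fun s => (f.argDeriv s).im) a.im t :=
    (Complex.imCLM.hasFDerivAt.comp_hasDerivAt t h1)
  simp only [f.argDeriv_im] at h3
  have h4 := h3.unique (hasDerivAt_const t 0)
  exact ⟨a.re, fun h => ha0 (Complex.ext h h4), h2⟩

variable {f}

lemma IsArgOn.mono {A B : Set ℝ} {φ : ℝ → ℝ} (h : f.IsArgOn A φ) (hBA : B ⊆ A) :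
    f.IsArgOn B φ := ⟨h.1.mono hBA, fun t ht => h.2 t (hBA ht)⟩

lemma IsArgOn.neg {A : Set ℝ} {φ : ℝ → ℝ} (h : f.IsArgOn A φ) :
    f.swap.IsArgOn A (fun t => -φ t) :=
  ⟨h.1.neg, fun t ht => by rw [val_swap, h.2 t ht, circlePt_neg]⟩

lemma Face.arg_sub_eq_aux {u v : ℝ} (hu : 0 < u) (hu' : u < 2 * Real.pi) (hv : 0 < v)
    (hv' : v < 2 * Real.pi) (h : circlePt u = circlePt v) : u = v := by
  rcases lt_trichotomy u v with h1 | h1 | h1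
  · exact (circlePt_ne h1 (by linarith) h.symm).elim
  · exact h1
  · exact (circlePt_ne h1 (by linarith) h).elim

/-- On an arc of the boundary of a face, each choice of the argument of `f` agrees with the angle
of the boundary of the face, up to a constant. -/
lemma Face.isArgOn_sub_eq (G : Face f) {a b : ℝ} (hab : b < a + 2 * Real.pi)
    (hS : Icc a b ⊆ G.angles) {φ : ℝ → ℝ} (hφ : f.IsArgOn (Icc a b) φ) {t t' : ℝ}
    (ht : t ∈ Icc a b) (ht' : t' ∈ Icc a b) : φ t' - φ t = G.arg t' - G.arg t := by
  suffices h : ∀ t ∈ Icc a b, ∀ t' ∈ Icc a b, t < t' → φ t' - φ t = G.arg t' - G.arg t by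
    rcases lt_trichotomy t t' with h1 | rfl | h1
    · exact h t ht t' ht' h1
    · simp
    · have := h t' ht' t ht h1
      linarith
  have hcirc : ∀ t ∈ Icc a b, circlePt (φ t) = circlePt (G.arg t) := fun t ht => by
    rw [← hφ.2 t ht, G.circlePt_arg (hS ht)]
  have hne : ∀ t ∈ Icc a b, ∀ t' ∈ Icc a b, t < t' → circlePt (φ t) ≠ circlePt (φ t') := by
    intro t ht t' ht' h h1
    rw [hcirc t ht, hcirc t' ht'] at h1
    exact circlePt_ne (G.arg_lt (hS ht) (hS ht') h (by linarith [ht.1, ht'.2]))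
      (G.arg_lt_add (hS ht) (hS ht') h (by linarith [ht.1, ht'.2])) h1.symm
  have hinj : InjOn φ (Icc a b) := by
    intro t ht t' ht' h
    by_contra hn
    rcases lt_or_gt_of_ne hn with h1 | h1
    · exact hne t ht t' ht' h1 (by rw [h])
    · exact hne t' ht' t ht h1 (by rw [h])
  have hsub : ∀ t ∈ Icc a b, ∀ t' ∈ Icc a b, circlePt (φ t' - φ t) = circlePt (G.arg t' - G.arg t) := by
    intro t ht t' ht'
    rw [circlePt_sub, circlePt_sub, hcirc t ht, hcirc t' ht']
  intro t ht t' ht' htt'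
  have hc : ContinuousOn φ (Icc t t') := hφ.1.mono (Icc_subset_Icc ht.1 ht'.2)
  have hσ : ∀ t ∈ Icc a b, ∀ t' ∈ Icc a b, t < t' → 0 < G.arg t' - G.arg t ∧
      G.arg t' - G.arg t < 2 * Real.pi := fun t ht t' ht' h => by
    have h1 := G.arg_lt (hS ht) (hS ht') h (by linarith [ht.1, ht'.2])
    have h2 := G.arg_lt_add (hS ht) (hS ht') h (by linarith [ht.1, ht'.2])
    constructor <;> linarith
  -- φ is continuous and injective modulo 2π, hence strictly monotone with increments of absolute
  -- value less than 2π.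
  rcases hφ.1.strictMonoOn_of_injOn_Icc' (ht.1.trans ht.2) hinj with hm | hm
  · have h1 : φ t < φ t' := hm ht ht' htt'
    have h2 : φ t' - φ t < 2 * Real.pi := by
      by_contra! h2
      obtain ⟨u, hu, hue⟩ := intermediate_value_Icc htt'.le hc
        (show φ t + 2 * Real.pi ∈ Icc (φ t) (φ t') from ⟨by linarith [Real.pi_pos], by linarith⟩)
      have hu' : t < u := lt_of_le_of_ne hu.1 fun h => by
        rw [← h] at hue
        linarith [Real.pi_pos]
      refine hne t ht u ⟨ht.1.trans hu.1, hu.2.trans ht'.2⟩ hu' ?_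
      rw [hue, circlePt_add_two_pi]
    exact arg_sub_eq_aux (by linarith) h2 (hσ t ht t' ht' htt').1 (hσ t ht t' ht' htt').2
      (hsub t ht t' ht')
  -- If φ decreased, every face increment would be a φ-increment plus 2π, which is not additive when
  -- the interval is split.
  · exfalso
    have hlow : ∀ s ∈ Icc a b, ∀ s' ∈ Icc a b, s < s' → G.arg s' - G.arg s = φ s' - φ s + 2 * Real.pi := by
      intro s hs s' hs' hss'
      have h1 : φ s' < φ s := hm hs hs' hss'
      have h2 : -(2 * Real.pi) < φ s' - φ s := by
        by_contra! h2
        have hc : ContinuousOn φ (Icc s s') := hφ.1.mono (Icc_subset_Icc hs.1 hs'.2)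
        obtain ⟨u, hu, hue⟩ := intermediate_value_Icc' hss'.le hc
          (show φ s - 2 * Real.pi ∈ Icc (φ s') (φ s) from ⟨by linarith, by linarith [Real.pi_pos]⟩)
        have hu' : s < u := lt_of_le_of_ne hu.1 fun h => by
          rw [← h] at hue
          linarith [Real.pi_pos]
        refine hne s hs u ⟨hs.1.trans hu.1, hu.2.trans hs'.2⟩ hu' ?_
        rw [← circlePt_add_two_pi (φ u), hue, sub_add_cancel]
      exact arg_sub_eq_aux (hσ s hs s' hs' hss').1 (hσ s hs s' hs' hss').2 (by linarith) (by linarith)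
        (by rw [circlePt_add_two_pi, hsub s hs s' hs'])
    obtain ⟨m, hm1, hm2⟩ := exists_between htt'
    have hmI : m ∈ Icc a b := ⟨ht.1.trans hm1.le, hm2.le.trans ht'.2⟩
    have k1 := hlow t ht m hmI hm1
    have k2 := hlow m hmI t' ht' hm2
    have k3 := hlow t ht t' ht' htt'
    linarith [Real.pi_pos]

/-! ### Faces of both kinds -/

variable (f) in
/-- A face of the net inside the disc: a face of `f` is mapped to the disc, a face of `1 / f` is
mapped by `f` to the complement of the disc. -/
def SFace := Face f ⊕ Face f.swap

namespace SFace

instance : Finite (SFace f) := inferInstanceAs (Finite (Face f ⊕ Face f.swap))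

/-- The angles of the points of the unit circle on the boundary of a face. -/
def angles : SFace f → Set ℝ := Sum.elim Face.angles Face.angles

/-- `1` for a face that is mapped to the disc, and `-1` otherwise. -/
def sgn : SFace f → ℝ := Sum.elim 1 (-1)

/-- The argument of `f` along the boundary of a face. -/
noncomputable def arg : SFace f → ℝ → ℝ := Sum.elim Face.arg fun H t => -H.arg t

lemma sgn_eq (A : SFace f) : A.sgn = 1 ∨ A.sgn = -1 := by
  rcases A with G | H
  · exact Or.inl rfl
  · exact Or.inr rfl

lemma sgn_mul_self (A : SFace f) : A.sgn * A.sgn = 1 := by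
  rcases A.sgn_eq with h | h <;> rw [h] <;> norm_num

lemma isClosed_angles (A : SFace f) : IsClosed A.angles := by
  rcases A with G | H
  · exact G.isClosed_angles
  · exact H.isClosed_angles

lemma add_two_pi_mem_angles (A : SFace f) {t : ℝ} : t + 2 * Real.pi ∈ A.angles ↔ t ∈ A.angles := by
  rcases A with G | H
  · exact Face.add_two_pi_mem_angles
  · exact Face.add_two_pi_mem_angles

lemma mem_angles_congr (A : SFace f) {t t' : ℝ} (h : circlePt t = circlePt t') :
    t ∈ A.angles ↔ t' ∈ A.angles := by
  rcases A with G | H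
  · change t ∈ G.angles ↔ t' ∈ G.angles
    rw [Face.mem_angles_iff, Face.mem_angles_iff, h]
  · change t ∈ H.angles ↔ t' ∈ H.angles
    rw [Face.mem_angles_iff, Face.mem_angles_iff, h]

/-- Branches of one kind that agree at a noncritical point coincide, and faces of different kinds
share circle points only at vertices. -/
lemma eq_of_mem {A B : SFace f} {t : ℝ} (hA : t ∈ A.angles) (hB : t ∈ B.angles)
    (ht : circlePt t ∉ f.vertices) : A = B := by
  have key {f : CircleRatFun} {G G' : Face f} (hG : t ∈ G.angles) (hG' : t ∈ G'.angles)
      (ht : f.W.eval (circlePt t) ≠ 0) : G = G' := by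
    rw [Face.mem_angles_iff] at hG hG'
    refine Face.eq_of_apply_eq (w := f.val (circlePt t)) ?_ (hG.trans hG'.symm) (by rwa [hG])
    simp [f.norm_val_circle (norm_circlePt t)]
  rcases A with G | H <;> rcases B with G' | H'
  · exact congrArg Sum.inl (key hA hB ht)
  · exact (ht (G.not_both H' (norm_circlePt t) (Face.mem_angles_iff.1 hA)
      (Face.mem_angles_iff.1 hB))).elim
  · exact (ht (G'.not_both H (norm_circlePt t) (Face.mem_angles_iff.1 hB)
      (Face.mem_angles_iff.1 hA))).elim
  · exact congrArg Sum.inr (key hA hB (by rwa [← not_mem_vertices_iff, vertices_swap]))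

/-- C has the kind of A or of B. The face of the other kind uses up one of the two local preimages,
so C coincides with the face of its own kind. -/
lemma eq_or_eq_of_simple {A B C : SFace f} {t : ℝ} (hA : t ∈ A.angles) (hB : t ∈ B.angles)
    (hC : t ∈ C.angles) (hAB : A.sgn ≠ B.sgn) (hW : f.W.eval (circlePt t) = 0)
    (hW' : (derivative f.W).eval (circlePt t) ≠ 0) : C = A ∨ C = B := by
  have key {f : CircleRatFun} {G G' : Face f} {H : Face f.swap} (hG : t ∈ G.angles)
      (hG' : t ∈ G'.angles) (hH : t ∈ H.angles) (hW : f.W.eval (circlePt t) = 0)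
      (hW' : (derivative f.W).eval (circlePt t) ≠ 0) : G = G' :=
    Face.eq_of_simple H (norm_circlePt t) hW hW' (Face.mem_angles_iff.1 hG)
      (Face.mem_angles_iff.1 hG') (Face.mem_angles_iff.1 hH)
  have hWs : f.swap.W.eval (circlePt t) = 0 := by rw [swap_W]; simp [hW]
  have hWs' : (derivative f.swap.W).eval (circlePt t) ≠ 0 := by rw [swap_W]; simpa using hW'
  rcases A with G | H <;> rcases B with G' | H'
  · exact (hAB rfl).elim
  · rcases C with K | K
    · exact Or.inl (congrArg Sum.inl (key hC hA hB hW hW'))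
    · exact Or.inr (congrArg Sum.inr (key hC hB (H := G) hA hWs hWs'))
  · rcases C with K | K
    · exact Or.inr (congrArg Sum.inl (key hC hB hA hW hW'))
    · exact Or.inl (congrArg Sum.inr (key hC hA (H := G') hB hWs hWs'))
  · exact (hAB rfl).elim

lemma arg_lt (A : SFace f) {t t' : ℝ} (ht : t ∈ A.angles) (ht' : t' ∈ A.angles) (h : t < t')
    (h' : t' < t + 2 * Real.pi) : 0 < A.sgn * (A.arg t' - A.arg t) ∧
      A.sgn * (A.arg t' - A.arg t) < 2 * Real.pi := by
  rcases A with G | H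
  · have h1 := G.arg_lt ht ht' h h'
    have h2 := G.arg_lt_add ht ht' h h'
    simp only [sgn, arg, Sum.elim_inl, Pi.one_apply]
    constructor <;> linarith
  · have h1 := H.arg_lt ht ht' h h'
    have h2 := H.arg_lt_add ht ht' h h'
    simp only [sgn, arg, Sum.elim_inr, Pi.neg_apply, Pi.one_apply]
    constructor <;> linarith

lemma circlePt_arg (A : SFace f) {t : ℝ} (ht : t ∈ A.angles) :
    circlePt (A.arg t) = f.val (circlePt t) := by
  rcases A with G | H
  · exact G.circlePt_arg ht
  · simp only [arg, Sum.elim_inr, circlePt_neg]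
    rw [H.circlePt_arg ht, val_swap, inv_inv]

lemma isArgOn_sub_eq (A : SFace f) {a b : ℝ} (hab : b < a + 2 * Real.pi)
    (hS : Icc a b ⊆ A.angles) {φ : ℝ → ℝ} (hφ : f.IsArgOn (Icc a b) φ) {t t' : ℝ}
    (ht : t ∈ Icc a b) (ht' : t' ∈ Icc a b) : φ t' - φ t = A.arg t' - A.arg t := by
  rcases A with G | H
  · exact G.isArgOn_sub_eq hab hS hφ ht ht'
  · have := H.isArgOn_sub_eq hab hS hφ.neg ht ht'
    simp only [arg, Sum.elim_inr]
    linarith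

/-- A gap between the points of the unit circle on the boundary of a face is filled by a chord,
and the face on the other side of the chord has no points of the unit circle outside the gap. -/
lemma chordJoins_of_gap (A : SFace f) {t₁ t₂ : ℝ} (h₁ : t₁ ∈ A.angles) (h₂ : t₂ ∈ A.angles)
    (h12 : t₁ < t₂) (h21 : t₂ < t₁ + 2 * Real.pi) (hgap : ∀ t ∈ Ioo t₁ t₂, t ∉ A.angles) :
    f.ChordJoins (circlePt t₁) (circlePt t₂) ∧ circlePt t₂ ∈ f.vertices ∧
      ∃ B : SFace f, B.sgn = -A.sgn ∧ t₁ ∈ B.angles ∧ t₂ ∈ B.angles ∧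
        ∀ t ∈ Ioo t₂ (t₁ + 2 * Real.pi), t ∉ B.angles := by
  rcases A with G | H
  · obtain ⟨h1, h2, K, h3, h4, h5⟩ := G.chordJoins_of_gap h₁ h₂ h12 h21 hgap
    exact ⟨h1, h2, Sum.inr K, rfl, h3, h4, h5⟩
  · obtain ⟨h1, h2, K, h3, h4, h5⟩ := H.chordJoins_of_gap h₁ h₂ h12 h21 hgap
    refine ⟨(f.chordJoins_swap _ _).1 h1, by rwa [vertices_swap] at h2, Sum.inl K, ?_, h3, h4, h5⟩
    exact (neg_neg (1 : ℝ)).symm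

/-- A monotone argument on both sides of a simple critical point is impossible. -/
lemma sgn_ne_of_simple {A B : SFace f} {a b c : ℝ} (hab : a < b) (hbc : b < c)
    (hac : c < a + 2 * Real.pi) (hA : Icc a b ⊆ A.angles) (hB : Icc b c ⊆ B.angles)
    (hW : f.W.eval (circlePt b) = 0) (hW' : (derivative f.W).eval (circlePt b) ≠ 0) :
    A.sgn ≠ B.sgn := by
  intro hs
  obtain ⟨φ, hφ, hφ'⟩ := f.exists_argument
  have hmono (C : SFace f) (u v : ℝ) (huv : v < u + 2 * Real.pi) (hC : Icc u v ⊆ C.angles) :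
      ∀ t ∈ Ioo u v, 0 ≤ C.sgn * (f.argDeriv t).re := by
    intro t ht
    have h1 : MonotoneOn (fun s => C.sgn * φ s) (Ioo u v) := by
      intro s hs s' hs' hss'
      rcases hss'.eq_or_lt with rfl | hlt
      · exact le_rfl
      · have h2 := C.isArgOn_sub_eq huv hC (hφ.mono (subset_univ _)) (Ioo_subset_Icc_self hs)
          (Ioo_subset_Icc_self hs')
        have h3 := (C.arg_lt (hC (Ioo_subset_Icc_self hs)) (hC (Ioo_subset_Icc_self hs')) hlt
          (by linarith [hs.1, hs'.2])).1
        rw [← h2, mul_sub] at h3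
        simp only
        linarith
    have h2 : HasDerivAt (fun s => C.sgn * φ s) (C.sgn * (f.argDeriv t).re) t := (hφ' t).const_mul _
    rw [← h2.hasDerivWithinAt.derivWithin (isOpen_Ioo.uniqueDiffWithinAt ht)]
    exact h1.derivWithin_nonneg
  obtain ⟨k, hk, hkd⟩ := f.hasDerivAt_argDeriv hW hW'
  -- With equal signs the signed derivative of the argument is nonnegative on both sides of b and 0
  -- at b, so its own derivative vanishes there, against simplicity.
  have hmin : IsLocalMin (fun s => A.sgn * (f.argDeriv s).re) b := by
    filter_upwards [Ioo_mem_nhds hab hbc] with s hs'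
    have h0 : A.sgn * (f.argDeriv b).re = 0 := by simp [argDeriv, hW]
    simp only [h0]
    rcases lt_trichotomy s b with h | rfl | h
    · exact hmono A a b (by linarith) hA s ⟨hs'.1, h⟩
    · exact h0.ge
    · rw [hs]
      exact hmono B b c (by linarith) hB s ⟨h, hs'.2⟩
  have h1 := hmin.hasDerivAt_eq_zero (hkd.const_mul A.sgn)
  rcases mul_eq_zero.1 h1 with h2 | h2
  · have := A.sgn_mul_self
    rw [h2] at this
    simp at this
  · exact hk h2

/-- Each arc of the unit circle without critical points is on the boundary of a face. -/
lemma exists_Icc_subset_angles (f : CircleRatFun) {a b : ℝ} (hab : a < b)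
    (hv : ∀ t ∈ Ioo a b, circlePt t ∉ f.vertices) : ∃ A : SFace f, Icc a b ⊆ A.angles := by
  have hcov : ∀ t ∈ Ioo a b, ∃ A : SFace f, t ∈ A.angles := by
    intro t ht
    rcases f.exists_face_of_norm_eq (norm_circlePt t) (hv t ht) with ⟨G, hG⟩ | ⟨H, hH⟩
    · exact ⟨Sum.inl G, Face.mem_angles_iff.2 hG⟩
    · exact ⟨Sum.inr H, Face.mem_angles_iff.2 hH⟩
  obtain ⟨m, hm⟩ := nonempty_Ioo.2 hab
  obtain ⟨A, hA⟩ := hcov m hm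
  refine ⟨A, ?_⟩
  -- The open arc is covered by finitely many closed angle sets that are disjoint on it; being
  -- connected, it lies in one.
  have h1 : IsClosed (⋃ B : {B : SFace f // B ≠ A}, B.1.angles) :=
    isClosed_iUnion_of_finite fun B => B.1.isClosed_angles
  have h2 : Ioo a b ⊆ A.angles := by
    have h3 := isPreconnected_iff_subset_of_disjoint_closed.1 (isPreconnected_Ioo (a := a) (b := b))
      _ _ A.isClosed_angles h1 ?_ ?_
    · refine h3.resolve_right fun h => ?_
      obtain ⟨⟨B, hBA⟩, hB⟩ := mem_iUnion.1 (h hm)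
      exact hBA (eq_of_mem hB hA (hv m hm))
    · intro t ht
      obtain ⟨B, hB⟩ := hcov t ht
      by_cases hBA : B = A
      · exact Or.inl (hBA ▸ hB)
      · exact Or.inr (mem_iUnion.2 ⟨⟨B, hBA⟩, hB⟩)
    · refine eq_empty_iff_forall_notMem.2 fun t ht => ?_
      obtain ⟨⟨B, hBA⟩, hB⟩ := mem_iUnion.1 ht.2.2
      exact hBA (eq_of_mem hB ht.2.1 (hv t ht.1))
  rw [← closure_Ioo hab.ne]
  exact closure_minimal h2 A.isClosed_angles

end SFace

lemma SFace.gap_congr (A : SFace f) {u₁ u₂ x₁ x₂ : ℝ} (hu : u₁ < u₂) (hu' : u₂ < u₁ + 2 * Real.pi)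
    (hx : x₁ < x₂) (hx' : x₂ < x₁ + 2 * Real.pi) (h₁ : circlePt u₁ = circlePt x₁)
    (h₂ : circlePt u₂ = circlePt x₂) (hgap : ∀ t ∈ Ioo u₁ u₂, t ∉ A.angles) :
    ∀ t ∈ Ioo x₁ x₂, t ∉ A.angles := by
  obtain ⟨k, hk⟩ := circlePt_eq_iff.1 h₁
  have h3 : u₂ - u₁ = x₂ - x₁ := Face.arg_sub_eq_aux (by linarith) (by linarith) (by linarith)
    (by linarith) (by rw [circlePt_sub, circlePt_sub, h₁, h₂])
  intro t ht htA
  refine hgap (t + k * (2 * Real.pi)) ⟨by linarith [ht.1], by linarith [ht.2]⟩ ?_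
  exact (A.mem_angles_congr (circlePt_eq_iff.2 ⟨k, rfl⟩)).2 htA

/-- Each chord that joins two points of an arc fills the gap of a face between them. -/
lemma SFace.exists_gap_of_chordJoins {x₁ x₂ : ℝ} (hx : x₁ < x₂) (hx' : x₂ < x₁ + 2 * Real.pi)
    (h : f.ChordJoins (circlePt x₁) (circlePt x₂)) : ∃ A : SFace f, x₁ ∈ A.angles ∧
      x₂ ∈ A.angles ∧ ∀ t ∈ Ioo x₁ x₂, t ∉ A.angles := by
  obtain ⟨G, t₁, ht₁, t₂, ht₂, h12, h21, hgap, ⟨e₁, e₂⟩ | ⟨e₁, e₂⟩⟩ :=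
    CircleRatFun.exists_gap_of_chordJoins (norm_circlePt x₁) (norm_circlePt x₂)
      (circlePt_ne hx hx').symm h
  · let A : SFace f := Sum.inl G
    exact ⟨A, (A.mem_angles_congr e₁).1 ht₁, (A.mem_angles_congr e₂).1 ht₂,
      A.gap_congr h12 h21 hx hx' e₁ e₂ hgap⟩
  -- The gap of G is the complementary arc here, and the face across the chord has its gap on the
  -- required side.
  · obtain ⟨-, -, B, -, hB₁, hB₂, hB⟩ :=
      SFace.chordJoins_of_gap (Sum.inl G : SFace f) ht₁ ht₂ h12 h21 hgap
    refine ⟨B, (B.mem_angles_congr e₂).1 hB₂, (B.mem_angles_congr e₁).1 hB₁,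
      B.gap_congr h21 (by linarith) hx hx' e₂ ?_ hB⟩
    rw [circlePt_add_two_pi, e₁]

/-! ### The sequence of faces along the arc -/

/-- `F i` is the face inside the disc that is adjacent to the arc from the angle `a i` to the angle
`a (i + 1)`, where `a 1 < ⋯ < a n` are the angles of all the vertices between `a 0` and
`a (n + 1)`, these vertices are simple, and the first face is mapped to the disc. -/
structure IsFaceSequence (f : CircleRatFun) (n : ℕ) (a : ℕ → ℝ) (F : ℕ → SFace f) : Prop where
  lt_succ : ∀ i ≤ n, a i < a (i + 1)
  width : a (n + 1) < a 0 + 2 * Real.pi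
  subset_angles : ∀ i ≤ n, Icc (a i) (a (i + 1)) ⊆ (F i).angles
  not_mem_vertices : ∀ i ≤ n, ∀ t ∈ Ioo (a i) (a (i + 1)), circlePt t ∉ f.vertices
  isRoot : ∀ m < n, f.W.eval (circlePt (a (m + 1))) = 0
  simple : ∀ m < n, (derivative f.W).eval (circlePt (a (m + 1))) ≠ 0
  sgn_zero : (F 0).sgn = 1

/-- The vertex with the number `k` is in the second row of the tableau. -/
def InSecondRow (f : CircleRatFun) (a : ℕ → ℝ) (k : ℕ) : Prop :=
  ∃ j, 1 ≤ j ∧ j < k ∧ f.ChordJoins (circlePt (a j)) (circlePt (a k))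

namespace IsFaceSequence

variable {n : ℕ} {a : ℕ → ℝ} {F : ℕ → SFace f} (hF : IsFaceSequence f n a F)

include hF

lemma monotone {i j : ℕ} (hij : i ≤ j) (hj : j ≤ n + 1) : a i ≤ a j := by
  induction j, hij using Nat.le_induction with
  | base => exact le_rfl
  | succ j hij ih => exact (ih (by omega)).trans (hF.lt_succ j (by omega)).le

lemma strictMono {i j : ℕ} (hij : i < j) (hj : j ≤ n + 1) : a i < a j :=
  (hF.lt_succ i (by omega)).trans_le (hF.monotone hij hj)

lemma lt_add {i j : ℕ} (hi : i ≤ n + 1) (hj : j ≤ n + 1) : a j < a i + 2 * Real.pi := by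
  have h1 := hF.monotone hj le_rfl
  have h2 := hF.monotone (Nat.zero_le i) hi
  linarith [hF.width]

lemma left_mem {i : ℕ} (hi : i ≤ n) : a i ∈ (F i).angles :=
  hF.subset_angles i hi (left_mem_Icc.2 (hF.lt_succ i hi).le)

lemma right_mem {i : ℕ} (hi : i ≤ n) : a (i + 1) ∈ (F i).angles :=
  hF.subset_angles i hi (right_mem_Icc.2 (hF.lt_succ i hi).le)

lemma eq_of_mem_Ioo {A : SFace f} {i : ℕ} (hi : i ≤ n) {t : ℝ} (ht : t ∈ Ioo (a i) (a (i + 1)))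
    (hA : t ∈ A.angles) : A = F i :=
  SFace.eq_of_mem hA (hF.subset_angles i hi (Ioo_subset_Icc_self ht)) (hF.not_mem_vertices i hi t ht)

lemma sgn_succ_ne {m : ℕ} (hm : m < n) : (F m).sgn ≠ (F (m + 1)).sgn :=
  SFace.sgn_ne_of_simple (hF.lt_succ m hm.le) (hF.lt_succ (m + 1) hm)
    (hF.lt_add (by omega) (by omega)) (hF.subset_angles m hm.le) (hF.subset_angles (m + 1) hm)
    (hF.isRoot m hm) (hF.simple m hm)

lemma sgn_eq {i : ℕ} (hi : i ≤ n) : (F i).sgn = (-1) ^ i := by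
  induction i with
  | zero => simpa using hF.sgn_zero
  | succ i ih =>
    have h1 := hF.sgn_succ_ne hi
    rw [ih (by omega)] at h1
    rw [pow_succ]
    rcases neg_one_pow_eq_or ℝ i with h | h <;> rcases (F (i + 1)).sgn_eq with h' | h' <;>
      rw [h, h'] at h1 <;> rw [h, h'] <;> first | exact (h1 rfl).elim | norm_num

lemma eq_or_eq {A : SFace f} {m : ℕ} (hm : m < n) (hA : a (m + 1) ∈ A.angles) :
    A = F m ∨ A = F (m + 1) :=
  SFace.eq_or_eq_of_simple (hF.right_mem hm.le) (hF.left_mem hm) hA (hF.sgn_succ_ne hm)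
    (hF.isRoot m hm) (hF.simple m hm)

omit hF in
lemma exists_mem_Ico {i k : ℕ} (hik : i ≤ k) {t : ℝ} (ht : t ∈ Ico (a i) (a k)) :
    ∃ m, i ≤ m ∧ m < k ∧ t ∈ Ico (a m) (a (m + 1)) := by
  induction k, hik using Nat.le_induction with
  | base => exact absurd ht.2 (not_lt.2 ht.1)
  | succ k hik ih =>
    by_cases h : t < a k
    · obtain ⟨m, h1, h2, h3⟩ := ih ⟨ht.1, h⟩
      exact ⟨m, h1, by omega, h3⟩
    · exact ⟨k, hik, by omega, not_lt.1 h, ht.2⟩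

/-- The faces on the outer side of a chord. -/
lemma eq_of_chordJoins {j k : ℕ} (hjk : j + 1 < k) (hk : k ≤ n)
    (h : f.ChordJoins (circlePt (a (j + 1))) (circlePt (a k))) : F j = F k := by
  obtain ⟨k, rfl⟩ : ∃ k', k = k' + 1 := ⟨k - 1, by omega⟩
  obtain ⟨A, h1, h2, hgap⟩ := SFace.exists_gap_of_chordJoins (hF.strictMono hjk (by omega))
    (hF.lt_add (by omega) (by omega)) h
  -- A has no angles strictly between the ends of the chord, so it is none of the faces of the arcs
  -- in between; at each end only the outer face remains.
  have key : ∀ m, j + 1 ≤ m → m ≤ k → A ≠ F m := by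
    rintro m hm1 hm2 rfl
    have h3 := hF.lt_succ m (by omega)
    obtain ⟨t, ht⟩ := nonempty_Ioo.2 h3
    refine hgap t ⟨?_, ?_⟩ (hF.subset_angles m (by omega) (Ioo_subset_Icc_self ht))
    · exact (hF.monotone hm1 (by omega)).trans_lt ht.1
    · exact ht.2.trans_le (hF.monotone (by omega) (by omega))
  have e1 := (hF.eq_or_eq (by omega) h1).resolve_right (key _ le_rfl (by omega))
  have e2 := (hF.eq_or_eq (by omega) h2).resolve_left (key _ (by omega) le_rfl)
  exact e1.symm.trans e2

/-- Used through its contrapositive: the vertex that opens the first arc on a face is in the first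
row. -/
lemma exists_eq_of_inSecondRow {k : ℕ} (hk : k ≤ n) (h : InSecondRow f a k) :
    ∃ j < k, F j = F k := by
  obtain ⟨j, hj, hjk, hc⟩ := h
  obtain ⟨j, rfl⟩ : ∃ j', j = j' + 1 := ⟨j - 1, by omega⟩
  exact ⟨j, by omega, hF.eq_of_chordJoins hjk hk hc⟩

/-- Consecutive arcs on the boundary of one face are separated by a chord. -/
lemma of_consecutive {i k : ℕ} (hik : i < k) (hk : k ≤ n) (hFik : F i = F k)
    (hcons : ∀ m, i < m → m < k → F m ≠ F k) :
    i + 1 < k ∧ InSecondRow f a k ∧ F (i + 1) = F (k - 1) ∧ (∀ j ≤ i, F j ≠ F (i + 1)) ∧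
      (F k).arg (a k) - (F k).arg (a (i + 1)) = (F (i + 1)).arg (a k) -
        (F (i + 1)).arg (a (i + 1)) + (-1) ^ k * (2 * Real.pi) := by
  have hik' : i + 1 < k := by
    refine lt_of_le_of_ne hik fun h => ?_
    subst h
    exact hF.sgn_succ_ne (m := i) (by omega) (by rw [hFik])
  obtain ⟨k, rfl⟩ : ∃ k', k = k' + 1 := ⟨k - 1, by omega⟩
  rw [Nat.add_sub_cancel]
  have hlt := hF.strictMono hik' (by omega)
  have hlt' := hF.lt_add (i := i + 1) (j := k + 1) (by omega) (by omega)
  have hm1 : a (i + 1) ∈ (F (k + 1)).angles := by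
    rw [← hFik]; exact hF.right_mem (i := i) (by omega)
  have hm2 : a (k + 1) ∈ (F (k + 1)).angles := hF.left_mem hk
  -- Inside an arc only the face of that arc contains t, and at a vertex only the two neighbouring
  -- faces; all of these differ from F (k + 1).
  have hgap : ∀ t ∈ Ioo (a (i + 1)) (a (k + 1)), t ∉ (F (k + 1)).angles := by
    intro t ht htA
    obtain ⟨m, h1, h2, h3⟩ := exists_mem_Ico (a := a) hik'.le ⟨ht.1.le, ht.2⟩
    rcases h3.1.eq_or_lt with h4 | h4
    · obtain ⟨m, rfl⟩ : ∃ m', m = m' + 1 := ⟨m - 1, by omega⟩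
      have h5 : i + 1 ≠ m + 1 := by
        rintro h
        rw [← h] at h4
        exact ht.1.ne h4
      rw [← h4] at htA
      rcases hF.eq_or_eq (by omega) htA with h | h
      · exact hcons m (by omega) (by omega) h.symm
      · exact hcons (m + 1) (by omega) (by omega) h.symm
    · exact hcons m (by omega) (by omega) (hF.eq_of_mem_Ioo (by omega) ⟨h4, h3.2⟩ htA).symm
  obtain ⟨hch, -, B, hsB, hB1, hB2, hB⟩ := SFace.chordJoins_of_gap _ hm1 hm2 hlt hlt' hgap
  have hsne : B.sgn ≠ (F (k + 1)).sgn := by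
    rcases (F (k + 1)).sgn_eq with h | h <;> rw [hsB, h] <;> norm_num
  -- At each end of the chord two faces are possible, and the sign of B selects the one across the
  -- chord.
  have e1 : B = F (i + 1) := (hF.eq_or_eq (by omega) hB1).resolve_left fun h =>
    hsne (by rw [h, hFik])
  have e2 : B = F k := (hF.eq_or_eq (by omega) hB2).resolve_right fun h => hsne (by rw [h])
  refine ⟨hik', ⟨i + 1, by omega, hik', hch⟩, e1.symm.trans e2, fun j hj hjB => ?_, ?_⟩
  · obtain ⟨t, ht⟩ := nonempty_Ioo.2 (hF.lt_succ j (by omega))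
    have htB := hF.subset_angles j (by omega) (Ioo_subset_Icc_self ht)
    rw [hjB, ← e1] at htB
    -- Shifted by a full turn, an earlier arc lies in the gap of B.
    refine hB (t + 2 * Real.pi) ⟨?_, ?_⟩ (B.add_two_pi_mem_angles.2 htB)
    · linarith [hF.lt_add (i := j) (j := k + 1) (by omega) (by omega), ht.1]
    · have := hF.monotone (i := j + 1) (j := i + 1) (by omega) (by omega)
      linarith [ht.2]
  · rw [← e1]
    set A := F (k + 1)
    have hsA : A.sgn = (-1) ^ (k + 1) := hF.sgn_eq hk
    obtain ⟨u1, u2⟩ := A.arg_lt hm1 hm2 hlt hlt'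
    obtain ⟨v1, v2⟩ := B.arg_lt hB1 hB2 hlt hlt'
    rw [hsB] at v1 v2
    -- The two increments are congruent modulo 2π, have opposite signs and are shorter than a turn,
    -- so they differ by exactly one turn with the sign of A.
    have hc : circlePt (A.arg (a (k + 1)) - A.arg (a (i + 1))) =
        circlePt (B.arg (a (k + 1)) - B.arg (a (i + 1))) := by
      rw [circlePt_sub, circlePt_sub, A.circlePt_arg hm1, A.circlePt_arg hm2,
        B.circlePt_arg hB1, B.circlePt_arg hB2]
    rw [← hsA]
    rcases A.sgn_eq with h | h <;> rw [h] at u1 u2 v1 v2 ⊢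
    · have := Face.arg_sub_eq_aux (u := A.arg (a (k + 1)) - A.arg (a (i + 1)))
        (v := B.arg (a (k + 1)) - B.arg (a (i + 1)) + 2 * Real.pi) (by linarith) (by linarith)
        (by linarith) (by linarith) (by rw [circlePt_add_two_pi, hc])
      linarith
    · have := Face.arg_sub_eq_aux (u := A.arg (a (k + 1)) - A.arg (a (i + 1)) + 2 * Real.pi)
        (v := B.arg (a (k + 1)) - B.arg (a (i + 1))) (by linarith) (by linarith)
        (by linarith) (by linarith) (by rw [circlePt_add_two_pi, hc])
      linarith

end IsFaceSequence

/-! ### Counting entries and bounding the argument -/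

open Classical in
/-- The number of entries of the second row of the tableau up to `k` that satisfy `p`. -/
noncomputable def rowCount (f : CircleRatFun) (a : ℕ → ℝ) (p : ℕ → Prop) (k : ℕ) : ℕ :=
  ((Finset.range (k + 1)).filter fun m => InSecondRow f a m ∧ p m).card

lemma rowCount_zero (a : ℕ → ℝ) (p : ℕ → Prop) : rowCount f a p 0 = 0 := by
  classical
  rw [rowCount, Finset.card_eq_zero, Finset.filter_eq_empty_iff]
  rintro m hm ⟨⟨j, hj⟩, -⟩
  simp at hm
  omega

open Classical in
lemma rowCount_succ (a : ℕ → ℝ) (p : ℕ → Prop) (k : ℕ) : rowCount f a p (k + 1) =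
    rowCount f a p k + if InSecondRow f a (k + 1) ∧ p (k + 1) then 1 else 0 := by
  rw [rowCount, Finset.range_add_one, Finset.filter_insert]
  split_ifs with h
  · rw [Finset.card_insert_of_notMem (by simp)]
    rfl
  · rfl

namespace IsFaceSequence

variable {n : ℕ} {a : ℕ → ℝ} {F : ℕ → SFace f} (hF : IsFaceSequence f n a F)

include hF

/-- The change of the argument between two arcs of the boundary of one face. -/
lemma argument_sub_eq {φ : ℝ → ℝ} (hφ : f.IsArgOn (Icc (a 0) (a (n + 1))) φ) (d : ℕ) :
    ∀ i k, k = i + d → k ≤ n → F i = F k → ∀ t ∈ Icc (a i) (a (i + 1)),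
      ∀ t' ∈ Icc (a k) (a (k + 1)),
        φ t' - φ t = (F k).arg t' - (F k).arg t + 2 * Real.pi *
          (((rowCount f a Odd k : ℝ) - rowCount f a Odd i) -
            ((rowCount f a Even k : ℝ) - rowCount f a Even i)) ∧
        (d : ℝ) = 2 * (((rowCount f a Odd k : ℝ) - rowCount f a Odd i) +
            ((rowCount f a Even k : ℝ) - rowCount f a Even i)) := by
  have hedge : ∀ i ≤ n, ∀ t ∈ Icc (a i) (a (i + 1)), ∀ t' ∈ Icc (a i) (a (i + 1)),
      φ t' - φ t = (F i).arg t' - (F i).arg t := fun i hi t ht t' ht' =>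
    (F i).isArgOn_sub_eq (hF.lt_add (by omega) (by omega)) (hF.subset_angles i hi)
      (hφ.mono (Icc_subset_Icc (hF.monotone (by omega) (by omega))
        (hF.monotone (by omega) (by omega)))) ht ht'
  induction d using Nat.strong_induction_on with
  | _ d ih =>
    rintro i k rfl hk hFik t ht t' ht'
    rcases Nat.eq_zero_or_pos d with rfl | hd
    · have := hedge i hk t ht t' ht'
      simp only [add_zero, sub_self, mul_zero, Nat.cast_zero]
      exact ⟨this, trivial⟩
    · classical
      -- the last arc before `k` on the same face
      set i' := Nat.findGreatest (fun m => F m = F (i + d)) (i + d - 1) with hi'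
      have h1 : F i' = F (i + d) :=
        Nat.findGreatest_spec (P := fun m => F m = F (i + d)) (m := i) (by omega) hFik
      have h2 : i ≤ i' := Nat.le_findGreatest (by omega) hFik
      have h3 : i' ≤ i + d - 1 := Nat.findGreatest_le _
      have h4 : ∀ m, i' < m → m < i + d → F m ≠ F (i + d) := fun m hm hm' =>
        Nat.findGreatest_is_greatest hm (by omega)
      -- The chord from i' + 1 to i + d splits the stretch into a shorter one on the same face and a
      -- shorter one on the face across, followed by the arc i + d. The vertex i' + 1 adds no
      -- second-row entry; i + d adds one, together with a turn whose sign depends on its parity.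
      obtain ⟨h5, h6, h7, h8, h9⟩ := hF.of_consecutive (i := i') (by omega) hk h1 h4
      have hn6 : ¬ InSecondRow f a (i' + 1) := fun h => by
        obtain ⟨j, hj, hjF⟩ := hF.exists_eq_of_inSecondRow (by omega) h
        exact h8 j (by omega) hjF
      have ha1 : a (i' + 1) ∈ Icc (a i') (a (i' + 1)) :=
        right_mem_Icc.2 (hF.lt_succ i' (by omega)).le
      obtain ⟨p1, p2⟩ := ih (i' - i) (by omega) i i' (by omega) (by omega) (hFik.trans h1.symm)
        t ht _ ha1
      have hk1 : i + d - 1 + 1 = i + d := by omega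
      have ha2 : a (i + d) ∈ Icc (a (i + d - 1)) (a (i + d - 1 + 1)) := by
        rw [hk1]
        exact right_mem_Icc.2 (hF.monotone (by omega) (by omega))
      obtain ⟨q1, q2⟩ := ih (i + d - 1 - (i' + 1)) (by omega) (i' + 1) (i + d - 1) (by omega)
        (by omega) h7 _ (left_mem_Icc.2 (hF.lt_succ (i' + 1) (by omega)).le) _ ha2
      have r1 := hedge (i + d) hk _ (left_mem_Icc.2 (hF.lt_succ (i + d) hk).le) t' ht'
      rw [← h7] at q1
      rw [h1] at p1
      have cE1 := rowCount_succ (f := f) a Even i'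
      have cO1 := rowCount_succ (f := f) a Odd i'
      have cE2 := rowCount_succ (f := f) a Even (i + d - 1)
      have cO2 := rowCount_succ (f := f) a Odd (i + d - 1)
      rw [if_neg (fun h => hn6 h.1), add_zero] at cE1 cO1
      rw [hk1] at cE2 cO2
      rw [cE1, cO1] at q1 q2
      rw [Nat.cast_sub h2] at p2
      rw [Nat.cast_sub (by omega), Nat.cast_sub (by omega)] at q2
      push_cast at q2
      rcases Nat.even_or_odd (i + d) with he | ho
      · rw [if_pos ⟨h6, he⟩] at cE2
        rw [if_neg (fun h => Nat.not_odd_iff_even.2 he h.2)] at cO2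
        rw [he.neg_one_pow] at h9
        rw [cE2, cO2]
        push_cast at q1 q2 ⊢
        constructor <;> linarith
      · rw [if_neg (fun h => Nat.not_even_iff_odd.2 ho h.2)] at cE2
        rw [if_pos ⟨h6, ho⟩] at cO2
        rw [ho.neg_one_pow] at h9
        rw [cE2, cO2]
        push_cast at q1 q2 ⊢
        constructor <;> linarith

/-- Let i be the first arc on the face of arc k. From a i onwards `argument_sub_eq` gives the
increment up to a face increment shorter than one turn; up to a i, the right end of arc i − 1,
induction applies. The condition a 0 < t is needed because the lower bound for k = 0 is a strict 0.
-/
lemma argument_bounds {φ : ℝ → ℝ} (hφ : f.IsArgOn (Icc (a 0) (a (n + 1))) φ) (k : ℕ) (hk : k ≤ n) :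
    ∀ t ∈ Icc (a k) (a (k + 1)), a 0 < t →
      (((k + 1) % 2 : ℕ) - (k : ℝ) + 4 * rowCount f a Odd k - 1) * Real.pi < φ t - φ (a 0) ∧
      φ t - φ (a 0) < (((k + 1) % 2 : ℕ) + (k : ℝ) - 4 * rowCount f a Even k + 1) * Real.pi := by
  induction k using Nat.strong_induction_on with
  | _ k ih =>
    intro t ht h0t
    classical
    have hex : ∃ i, F i = F k := ⟨k, rfl⟩
    set i := Nat.find hex
    have hi : F i = F k := Nat.find_spec hex
    have hik : i ≤ k := Nat.find_min' hex rfl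
    have hmin : ∀ j < i, F j ≠ F k := fun j hj => Nat.find_min hex hj
    obtain ⟨p1, p2⟩ := hF.argument_sub_eq hφ (k - i) i k (by omega) hk hi (a i)
      (left_mem_Icc.2 (hF.lt_succ i (by omega)).le) t ht
    rw [Nat.cast_sub hik] at p2
    have hai : a i ∈ (F k).angles := hi ▸ hF.left_mem (by omega)
    have hat : t ∈ (F k).angles := hF.subset_angles k hk ht
    have hit : a i ≤ t := (hF.monotone hik (by omega)).trans ht.1
    have hti : t < a i + 2 * Real.pi := ht.2.trans_lt (hF.lt_add (by omega) (by omega))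
    have hsk := hF.sgn_eq hk
    have hsi := hF.sgn_eq (hik.trans hk)
    have hpi := Real.pi_pos
    -- If i = 0, then k = 2(O + E) is even, and the claimed bounds are exactly 2π(O − E) and 2π(O −
    -- E + 1).
    rcases Nat.eq_zero_or_pos i with hi0 | hi0
    · rw [hi0] at p1 p2 hsi hai hit hti hi
      have hs1 : (F k).sgn = 1 := by rw [← hi, hsi]; simp
      obtain ⟨u1, u2⟩ := (F k).arg_lt hai hat h0t hti
      rw [hs1] at hsk u1 u2
      have hke : Even k := by
        by_contra h
        rw [(Nat.not_even_iff_odd.1 h).neg_one_pow] at hsk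
        norm_num at hsk
      have hmod : (k + 1) % 2 = 1 := by
        obtain ⟨c, rfl⟩ := hke; omega
      rw [rowCount_zero, rowCount_zero] at p1 p2
      rw [hmod]
      push_cast at p1 p2 ⊢
      constructor <;> nlinarith
    · obtain ⟨i', hi'⟩ : ∃ i', i = i' + 1 := ⟨i - 1, by omega⟩
      have hnR : ¬ InSecondRow f a (i' + 1) := fun h => by
        obtain ⟨j, hj, hjF⟩ := hF.exists_eq_of_inSecondRow (by omega) h
        exact hmin j (by omega) (hjF.trans (hi' ▸ hi))
      have cE := rowCount_succ (f := f) a Even i'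
      have cO := rowCount_succ (f := f) a Odd i'
      rw [if_neg (fun h => hnR h.1), add_zero] at cE cO
      obtain ⟨l1, l2⟩ := ih i' (by omega) (by omega) (a (i' + 1))
        (right_mem_Icc.2 (hF.lt_succ i' (by omega)).le) (hF.strictMono (by omega) (by omega))
      rw [hi', cE, cO] at p1 p2
      rw [hi'] at hit hti hai
      have hu : 0 ≤ (F k).sgn * ((F k).arg t - (F k).arg (a (i' + 1))) ∧
          (F k).sgn * ((F k).arg t - (F k).arg (a (i' + 1))) < 2 * Real.pi := by
        rcases hit.eq_or_lt with h | h
        · rw [h]; simp [hpi]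
        · obtain ⟨u1, u2⟩ := (F k).arg_lt hai hat h hti
          exact ⟨u1.le, u2⟩
      obtain ⟨u1, u2⟩ := hu
      have hsk' : (F k).sgn = (-1) ^ (i' + 1) := by rw [← hi, hsi, hi']
      rw [hsk'] at hsk u1 u2
      push_cast at p1 p2
      -- k and i' + 1 have the same parity. The last face contributes an amount in [0, 2π) for even
      -- k and in (−2π, 0] for odd k; the change of the term modulo 2 between i' and k fits this to
      -- the widened interval.
      rcases Nat.even_or_odd k with he | ho
      · rw [he.neg_one_pow] at hsk
        rw [hsk] at u1 u2
        have hpar : Even (i' + 1) := by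
          by_contra h
          rw [(Nat.not_even_iff_odd.1 h).neg_one_pow] at hsk
          norm_num at hsk
        have hmod : (k + 1) % 2 = 1 := by obtain ⟨c, rfl⟩ := he; omega
        have hmod' : (i' + 1) % 2 = 0 := Nat.even_iff.1 hpar
        rw [hmod'] at l1 l2
        rw [hmod]
        push_cast at l1 l2 ⊢
        constructor <;> nlinarith
      · rw [ho.neg_one_pow] at hsk
        rw [hsk] at u1 u2
        have hpar : Odd (i' + 1) := by
          by_contra h
          rw [(Nat.not_odd_iff_even.1 h).neg_one_pow] at hsk
          norm_num at hsk
        have hmod : (k + 1) % 2 = 0 := by obtain ⟨c, rfl⟩ := ho; omega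
        have hmod' : (i' + 1) % 2 = 1 := Nat.odd_iff.1 hpar
        rw [hmod'] at l1 l2
        rw [hmod]
        push_cast at l1 l2 ⊢
        constructor <;> nlinarith

end IsFaceSequence

/-! ### From the list of vertices to the sequence of faces -/

/-- The angles of the ends of an arc together with those of the vertices inside. -/
noncomputable def edgeAngle (α β : ℝ) {n : ℕ} (θ : Fin n → ℝ) (k : ℕ) : ℝ :=
  if k = 0 then α else if h : k - 1 < n then θ ⟨k - 1, h⟩ else β

lemma edgeAngle_zero (α β : ℝ) {n : ℕ} (θ : Fin n → ℝ) : edgeAngle α β θ 0 = α := if_pos rfl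

lemma edgeAngle_succ (α β : ℝ) {n : ℕ} (θ : Fin n → ℝ) {k : ℕ} (hk : k < n) :
    edgeAngle α β θ (k + 1) = θ ⟨k, hk⟩ := by
  simp [edgeAngle, hk]

lemma edgeAngle_last (α β : ℝ) {n : ℕ} (θ : Fin n → ℝ) : edgeAngle α β θ (n + 1) = β := by
  simp [edgeAngle]

lemma mem_secondRow {n : ℕ} {θ : Fin n → ℝ} {m : ℕ} :
    m ∈ f.secondRow θ ↔
      ∃ i : Fin n, (∃ j < i, f.ChordJoins (circlePt (θ j)) (circlePt (θ i))) ∧ (i : ℕ) + 1 = m := by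
  classical
  simp [secondRow, Finset.bind_def, Finset.pure_def]

lemma card_secondRow_filter (α β : ℝ) {n : ℕ} (θ : Fin n → ℝ) (p : ℕ → Prop) [DecidablePred p] :
    ((f.secondRow θ).filter p).card = rowCount f (edgeAngle α β θ) p n := by
  classical
  rw [rowCount]
  congr 1
  ext m
  simp only [mem_secondRow, Finset.mem_filter, Finset.mem_range]
  constructor
  · rintro ⟨⟨i, ⟨j, hji, hc⟩, rfl⟩, hp⟩
    refine ⟨by omega, ⟨j + 1, by omega, by simpa using hji, ?_⟩, hp⟩
    rwa [edgeAngle_succ α β θ j.2, edgeAngle_succ α β θ i.2]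
  · rintro ⟨hm, ⟨j, hj1, hjm, hc⟩, hp⟩
    obtain ⟨j, rfl⟩ : ∃ j', j = j' + 1 := ⟨j - 1, by omega⟩
    obtain ⟨m, rfl⟩ : ∃ m', m = m' + 1 := ⟨m - 1, by omega⟩
    rw [edgeAngle_succ α β θ (by omega : j < n), edgeAngle_succ α β θ (by omega : m < n)] at hc
    exact ⟨⟨⟨m, by omega⟩, ⟨⟨j, by omega⟩, by simpa using hjm, hc⟩, rfl⟩, hp⟩

lemma exists_isFaceSequence {α β : ℝ} (hαβ : α < β) (hβ : β < α + 2 * Real.pi) {n : ℕ}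
    {θ : Fin n → ℝ} (hθ : f.IsVertexList α β θ) (hsimple : ∀ i, f.IsSimpleVertex (circlePt (θ i)))
    (horient : f.OrientationPreservingOn α (if h : 0 < n then θ ⟨0, h⟩ else β)) :
    ∃ F, IsFaceSequence f n (edgeAngle α β θ) F := by
  set a := edgeAngle α β θ with ha
  have ha0 : a 0 = α := edgeAngle_zero α β θ
  have hal : a (n + 1) = β := edgeAngle_last α β θ
  have has {k : ℕ} (hk : k < n) : a (k + 1) = θ ⟨k, hk⟩ := edgeAngle_succ α β θ hk
  have hmem (i : Fin n) : θ i ∈ Ioo α β ∧ circlePt (θ i) ∈ f.vertices := by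
    have : θ i ∈ range θ := ⟨i, rfl⟩
    rwa [hθ.2] at this
  have hlt : ∀ i ≤ n, a i < a (i + 1) := by
    intro i hi
    rcases Nat.eq_zero_or_pos i with rfl | hi0
    · rw [ha0]
      rcases Nat.eq_zero_or_pos n with rfl | hn
      · rw [hal]; exact hαβ
      · rw [has hn]; exact (hmem _).1.1
    · obtain ⟨i, rfl⟩ : ∃ i', i = i' + 1 := ⟨i - 1, by omega⟩
      rw [has hi]
      rcases hi.eq_or_lt with rfl | hi'
      · rw [hal]; exact (hmem _).1.2
      · rw [has hi']
        exact hθ.1 (by simp)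
  have hmono : ∀ i j, i ≤ j → j ≤ n + 1 → a i ≤ a j := by
    intro i j hij
    induction j, hij using Nat.le_induction with
    | base => exact fun _ => le_rfl
    | succ j hij ih => exact fun hj => (ih (by omega)).trans (hlt j (by omega)).le
  have hnv : ∀ i ≤ n, ∀ t ∈ Ioo (a i) (a (i + 1)), circlePt t ∉ f.vertices := by
    intro i hi t ht htv
    have h1 := hmono 0 i (by omega) (by omega)
    have h2 := hmono (i + 1) (n + 1) (by omega) le_rfl
    have h3 : t ∈ range θ := by
      rw [hθ.2]
      exact ⟨⟨by linarith [ht.1], by linarith [ht.2]⟩, htv⟩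
    obtain ⟨j, rfl⟩ := h3
    rw [← has j.2] at ht
    rcases le_or_gt ((j : ℕ) + 1) i with h | h
    · exact absurd (hmono _ _ h (by omega)) (not_le.2 ht.1)
    · exact absurd (hmono (i + 1) _ h (by omega)) (not_le.2 ht.2)
  have hex : ∀ i, ∃ A : SFace f, i ≤ n → Icc (a i) (a (i + 1)) ⊆ A.angles := by
    intro i
    by_cases hi : i ≤ n
    · obtain ⟨A, hA⟩ := SFace.exists_Icc_subset_angles f (hlt i hi) (hnv i hi)
      exact ⟨A, fun _ => hA⟩
    -- Beyond n any face serves as a default value; the one of arc 0 is at hand.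
    · obtain ⟨A, -⟩ := SFace.exists_Icc_subset_angles f (hlt 0 (by omega)) (hnv 0 (by omega))
      exact ⟨A, fun h => (hi h).elim⟩
  choose F hF using hex
  refine ⟨F, hlt, by rw [hal, ha0]; exact hβ, hF, hnv, fun m hm => ?_, fun m hm => ?_, ?_⟩
  · rw [has hm]; exact (hmem _).2
  · rw [has hm]; exact (hsimple _).derivative_ne_zero f.W_ne_zero
  · obtain ⟨φ, hφ, hφm⟩ := horient
    have h1 : (if h : 0 < n then θ ⟨0, h⟩ else β) = a 1 := by
      split_ifs with h
      · exact (has h).symm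
      · obtain rfl : n = 0 := by omega
        exact hal.symm
    rw [h1, ← ha0] at hφ hφm
    have h01 := hlt 0 (by omega)
    -- The increasing argument is given only on the open arc, so it is compared with that of F 0 on
    -- a closed subarc; this fixes the sign of F 0.
    obtain ⟨u, hu0, hu1⟩ := exists_between h01
    obtain ⟨v, huv, hv1⟩ := exists_between hu1
    have hsub : Icc u v ⊆ Ioo (a 0) (a (0 + 1)) := Icc_subset_Ioo hu0 hv1
    have hsub' : Icc u v ⊆ (F 0).angles := (hsub.trans Ioo_subset_Icc_self).trans (hF 0 (by omega))
    have hle := hmono (0 + 1) (n + 1) (by omega) le_rfl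
    have hvu : v < u + 2 * Real.pi := by linarith
    have hul := left_mem_Icc.2 huv.le
    have hvr := right_mem_Icc.2 huv.le
    have h2 := (F 0).isArgOn_sub_eq hvu hsub' (hφ.mono hsub) hul hvr
    have h3 := ((F 0).arg_lt (hsub' hul) (hsub' hvr) huv hvu).1
    have h4 := hφm (hsub hul) (hsub hvr) huv
    rw [← h2] at h3
    rcases (F 0).sgn_eq with h | h
    · exact h
    · rw [h] at h3
      linarith

end CircleRatFun

end

/-- The arc runs from `r = circlePt α` to `s = circlePt β`; every pair of distinct points of the
unit circle is of this form.  If there are no vertices in the arc, the arc from `r` to the first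
vertex is read as the arc from `r` to `s`. -/
theorem theorem5p1 (f : CircleRatFun) (α β : ℝ) (hαβ : α < β) (hβ : β < α + 2 * Real.pi)
    (n : ℕ) (θ : Fin n → ℝ) (hθ : f.IsVertexList α β θ)
    (hsimple : ∀ i, f.IsSimpleVertex (circlePt (θ i)))
    (horient : f.OrientationPreservingOn α (if h : 0 < n then θ ⟨0, h⟩ else β)) :
    (∃ l, f.HasArgIncrement α β l) ∧
      ∀ l, f.HasArgIncrement α β l →
        l ∈ Set.Ioo
          ((((n + 1) % 2 : ℕ) - (n : ℝ) + 4 * (f.oddEntries θ : ℝ) - 1) * Real.pi)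
          ((((n + 1) % 2 : ℕ) + (n : ℝ) - 4 * (f.evenEntries θ : ℝ) + 1) * Real.pi) := by
  refine ⟨?_, ?_⟩
  · obtain ⟨φ, hφ, -⟩ := f.exists_argument
    exact ⟨_, φ, hφ.mono (Set.subset_univ _), rfl⟩
  · rintro l ⟨φ, hφ, rfl⟩
    obtain ⟨F, hF⟩ := CircleRatFun.exists_isFaceSequence hαβ hβ hθ hsimple horient
    have ha0 := CircleRatFun.edgeAngle_zero α β θ
    have hal := CircleRatFun.edgeAngle_last α β θ
    have hβmem : β ∈ Set.Icc (CircleRatFun.edgeAngle α β θ n)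
        (CircleRatFun.edgeAngle α β θ (n + 1)) := by
      have := (hF.lt_succ n le_rfl).le
      rw [hal] at this ⊢
      exact ⟨this, le_rfl⟩
    have h1 := hF.argument_bounds (φ := φ) (by rwa [ha0, hal]) n le_rfl β hβmem (by rwa [ha0])
    rw [ha0] at h1
    rw [CircleRatFun.oddEntries, CircleRatFun.evenEntries,
      CircleRatFun.card_secondRow_filter α β, CircleRatFun.card_secondRow_filter α β]
    exact h1
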